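/- Let $K$ be a field. A simplicial complex $\Delta$ on a finite vertex set $V=V(\Delta)$ is a family of subsets of $V$ (its faces) that contains $\emptyset$ and is closed under taking subsets; $\Delta$ is a simplex if its faces are exactly the subsets of some set $F\subseteq V$, and $\dim\Delta=\max_{F\in\Delta}|F|-1$. Let $S=K[x_v : v\in V]$ and let $I_\Delta\subseteq S$ be the Stanley–Reisner ideal, generated by the monomials $x_N=\prod_{v\in N}x_v$ with $N\subseteq V$, $N\notin\Delta$. *Inseparability.* A monomial ideal $J\subseteq S[y]$ is a separation of a squarefree monomial ideal $I\subseteq S$ for the variable $x_i$ if (i) $I$ is the image of $J$ under the $K$-algebra homomorphism $S[y]\to S$ with $y\mapsto x_i$ and $x_j\mapsto x_j$ for all $j$; (ii) $x_i$ divides some minimal monomial generator of $J$, and $y$ divides some minimal monomial generator of $J$; (iii) $y-x_i$ is a non-zero-divisor on $S[y]/J$. The complex $\Delta$ is inseparable if $I_\Delta$ has no separation for any variable $x_i$. *Rigidity.* Let $I\subseteq S$ be an ideal. For an ideal $J\subseteq S[\epsilon]$, $\epsilon^2=0$, the ring $S[\epsilon]/J$ is an infinitesimal deformation of $S/I$ if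 $K[\epsilon]\to S[\epsilon]/J$ is flat and the image of $J$ under $S[\epsilon]\to S$, $\epsilon\mapsto 0$, is $I$; it is trivial if some $K$-algebra automorphism of $S[\epsilon]$ maps $J$ to $IS[\epsilon]$. The complex $\Delta$ is rigid if every infinitesimal deformation of $S/I_\Delta$ is trivial. *$\emptyset$-rigidity.* Let $T^1(\Delta)$ be the cokernel of the map $\mathrm{Der}_K(S)\to \mathrm{Hom}_S(I_\Delta,S/I_\Delta)$, $\partial\mapsto (f\mapsto \partial f+I_\Delta)$, with its natural $\mathbb Z^{V}$-grading. The complex $\Delta$ is $\emptyset$-rigid if $T^1(\Delta)_{-b}=0$ for all $b\in\{0,1\}^{V}$. **Theorem.** Let $\Delta_1\neq\{\emptyset\}$ and $\Delta_2\neq\{\emptyset\}$ be simplicial complexes on disjoint finite vertex sets $V(\Delta_1)$ and $V(\Delta_2)$ such that $\{v\}\in\Delta_i$ for all $v\in V(\Delta_i)$, $i=1,2$. Let $\Delta_1\cup\Delta_2$ be their disjoint union: the complex on $V(\Delta_1)\cup V(\Delta_2)$ whose faces are the faces of $\Delta_1$ and the faces of $\Delta_2$. (a) The following conditions are equivalent: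 (1) $\Delta_1\cup\Delta_2$ is inseparable; (2) $\Delta_1$ and $\Delta_2$ are simplices. (b) The following conditions are equivalent: (1) $\Delta_1\cup\Delta_2$ is rigid; (2) $\Delta_1\cup\Delta_2$ is $\emptyset$-rigid; (3) $\Delta_1$ and $\Delta_2$ are simplices and $\dim\Delta_1+\dim\Delta_2>0$. -/

import Mathlib

open scoped DualNumber

noncomputable section

/-! ### Simplicial complexes

A simplicial complex on a finite vertex set `V` is a `PreAbstractSimplicialComplex V`; a vertex
need not be a face. In this Mathlib structure the collection of faces consists of the nonempty
faces only: the empty set is a face by convention, and is not listed. Thus `⊥` is the complex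
whose only face is the empty set. -/

namespace PreAbstractSimplicialComplex

variable {V V₁ V₂ : Type*}

/-- `Δ` is a simplex: its faces are exactly the subsets of some set `F`. -/
def IsSimplex (Δ : PreAbstractSimplicialComplex V) : Prop :=
  ∃ F : Finset V, ∀ G : Finset V, G ∈ Δ.faces ↔ G.Nonempty ∧ G ⊆ F

/-- The dimension: the largest cardinality of a face, minus one (so `-1` if there is no nonempty
face). For finite `V` the set of cardinalities is bounded. -/
def dim (Δ : PreAbstractSimplicialComplex V) : ℤ :=
  ((sSup (Finset.card '' Δ.faces) : ℕ) : ℤ) - 1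

open Classical in
/-- The disjoint union: the vertex set is the disjoint union of the two vertex sets, and a set is a
face iff it is a face of `Δ₁` or a face of `Δ₂`. -/
def disjointUnion (Δ₁ : PreAbstractSimplicialComplex V₁) (Δ₂ : PreAbstractSimplicialComplex V₂) :
    PreAbstractSimplicialComplex (V₁ ⊕ V₂) :=
  Δ₁.map Sum.inl ⊔ Δ₂.map Sum.inr

/-- The Stanley–Reisner ideal: generated by the monomials `∏ i ∈ N, x_i`, `N` a non-face. -/
def stanleyReisnerIdeal (K : Type*) [Field K] (Δ : PreAbstractSimplicialComplex V) :
    Ideal (MvPolynomial V K) :=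
  Ideal.span {f | ∃ N : Finset V, N.Nonempty ∧ N ∉ Δ.faces ∧ f = ∏ i ∈ N, MvPolynomial.X i}

end PreAbstractSimplicialComplex

/-! ### Infinitesimal deformations and rigidity -/

section Deformation

variable (K : Type*) {S : Type*} [Field K] [CommRing S] [Algebra K S]

/-- The canonical map `K[ε] → S[ε]`, `a + bε ↦ a + bε`. -/
def dualNumberInclusion (S : Type*) [CommRing S] [Algebra K S] : K[ε] →ₐ[K] S[ε] :=
  DualNumber.lift ⟨(Algebra.ofId K S[ε], DualNumber.eps),
    DualNumber.eps_mul_eps, fun _ => Commute.all _ _⟩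

/-- `S[ε]/J` is an infinitesimal deformation of `S/I`: the map `K[ε] → S[ε]/J` is flat, and
reduction modulo `ε` yields `S/I`, that is, `J` reduces to `I` modulo `ε`. -/
def IsInfinitesimalDeformation (I : Ideal S) (J : Ideal S[ε]) : Prop :=
  RingHom.Flat (R := K[ε]) (S := S[ε] ⧸ J)
      ((Ideal.Quotient.mk J).comp (dualNumberInclusion K S).toRingHom) ∧
    J.map (TrivSqZeroExt.fstHom S S S) = I

/-- The deformation given by `J` is trivial: a `K`-algebra automorphism of `S[ε]` maps `J` to
`I S[ε]`. -/
def IsTrivialDeformation (I : Ideal S) (J : Ideal S[ε]) : Prop :=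
  ∃ σ : S[ε] ≃ₐ[K] S[ε], J.map σ = I.map (algebraMap S S[ε])

/-- `S/I` is rigid over `K`: every infinitesimal deformation of it is trivial. -/
def IsRigidQuotient (I : Ideal S) : Prop :=
  ∀ J : Ideal S[ε], IsInfinitesimalDeformation K I J → IsTrivialDeformation K I J

/-! ### The first cotangent functor -/

/-- The natural map `δ* : Der_K(S) → Hom_S(I, S/I)`, `∂ ↦ (f ↦ ∂ f + I)`. -/
def derivationToHom (I : Ideal S) : Derivation K S S →ₗ[S] (I →ₗ[S] S ⧸ I) where
  toFun D :=
    { toFun := fun f => Ideal.Quotient.mk I (D f)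
      map_add' := fun f g => by simp
      map_smul' := fun r f => by
        have h : Ideal.Quotient.mk I ((f : S) * D r) = 0 :=
          Ideal.Quotient.eq_zero_iff_mem.2 (I.mul_mem_right _ f.2)
        simp only [Submodule.coe_smul, smul_eq_mul, Derivation.leibniz, map_add, h, add_zero,
          RingHom.id_apply]
        rfl }
  map_add' D E := by ext f; simp
  map_smul' r D := by ext f; rfl

/-- `T¹(S/I)`, the cokernel of `δ*`. -/
abbrev CotangentT1 (I : Ideal S) : Type _ :=
  (I →ₗ[S] S ⧸ I) ⧸ LinearMap.range (derivationToHom K I)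

end Deformation

section Grading

variable {K V : Type*} [Field K]

/-- The component of degree `d ∈ ℤ^V` of `S/I`: spanned by the class of the monomial `x^d` if `d`
is nonnegative, and zero otherwise. -/
def quotientDegree (I : Ideal (MvPolynomial V K)) (d : V → ℤ) :
    Submodule K (MvPolynomial V K ⧸ I) :=
  Submodule.span K {q | ∃ u : V →₀ ℕ, (∀ v, (u v : ℤ) = d v) ∧
    q = Ideal.Quotient.mk I (MvPolynomial.monomial u 1)}

/-- For a monomial ideal `I`, the homomorphisms `I → S/I` that are homogeneous of degree
`c ∈ ℤ^V`: they send elements of degree `u` to elements of degree `u + c`. -/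
def homDegree (I : Ideal (MvPolynomial V K)) (c : V → ℤ) :
    Submodule K (I →ₗ[MvPolynomial V K] MvPolynomial V K ⧸ I) where
  carrier := {φ | ∀ (f : I) (u : V →₀ ℕ) (a : K), (f : MvPolynomial V K) =
    MvPolynomial.monomial u a → φ f ∈ quotientDegree I (fun v => (u v : ℤ) + c v)}
  add_mem' hφ hψ f u a h := Submodule.add_mem _ (hφ f u a h) (hψ f u a h)
  zero_mem' _ _ _ _ := Submodule.zero_mem _
  smul_mem' r _ hφ f u a h := Submodule.smul_mem _ r (hφ f u a h)

/-- For a monomial ideal `I`, the component of degree `c ∈ ℤ^V` of `T¹(S/I)`: the classes of the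
homomorphisms of degree `c`. -/
def cotangentT1Degree (I : Ideal (MvPolynomial V K)) (c : V → ℤ) :
    Submodule K (CotangentT1 K I) :=
  (homDegree I c).map ((LinearMap.range (derivationToHom K I)).mkQ.restrictScalars K)

/-! ### Separations -/

/-- The ideal `J` is generated by monomials. -/
def IsMonomialIdeal {W : Type*} (J : Ideal (MvPolynomial W K)) : Prop :=
  ∃ s : Set (W →₀ ℕ), J = Ideal.span ((fun u => MvPolynomial.monomial u (1 : K)) '' s)

/-- `x^u` is a minimal monomial generator of the monomial ideal `J`: it is minimal with respect to
divisibility among the monomials in `J`. -/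
def IsMinimalGenerator {W : Type*} (J : Ideal (MvPolynomial W K)) (u : W →₀ ℕ) : Prop :=
  Minimal (fun w : W →₀ ℕ => MvPolynomial.monomial w (1 : K) ∈ J) u

/-- `J ⊆ S[y]` is a separation of `I ⊆ S` for the variable `x_i`. Here `S[y]` is the polynomial
ring on `Option V`, where `none` gives the new variable `y` and `some j` gives `x_j`. -/
structure IsSeparation (I : Ideal (MvPolynomial V K)) (i : V)
    (J : Ideal (MvPolynomial (Option V) K)) : Prop where
  monomial : IsMonomialIdeal J
  map_eq : J.map (MvPolynomial.aeval (R := K)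
    (fun o : Option V => o.elim (MvPolynomial.X i) MvPolynomial.X)) = I
  dvd_x : ∃ u, IsMinimalGenerator J u ∧ u (some i) ≠ 0
  dvd_y : ∃ u, IsMinimalGenerator J u ∧ u none ≠ 0
  regular : Ideal.Quotient.mk J (MvPolynomial.X none - MvPolynomial.X (some i)) ∈
    nonZeroDivisors (MvPolynomial (Option V) K ⧸ J)

end Grading

namespace PreAbstractSimplicialComplex

variable (K : Type*) [Field K] {V : Type*}

/-- `Δ` is (algebraically) rigid over `K`. -/
def IsRigid (Δ : PreAbstractSimplicialComplex V) : Prop :=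
  IsRigidQuotient K (Δ.stanleyReisnerIdeal K)

/-- `Δ` is `∅`-rigid over `K`: `T¹(Δ)_{-b} = 0` for all `b ∈ {0,1}^V`. -/
def IsEmptyRigid (Δ : PreAbstractSimplicialComplex V) : Prop :=
  ∀ b : V → ℤ, (∀ v, b v = 0 ∨ b v = 1) →
    cotangentT1Degree (Δ.stanleyReisnerIdeal K) (-b) = ⊥

/-- `Δ` is inseparable over `K`: its Stanley–Reisner ideal has no separation for any variable. -/
def IsInseparable (Δ : PreAbstractSimplicialComplex V) : Prop :=
  ¬ ∃ (i : V) (J : Ideal (MvPolynomial (Option V) K)),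
    IsSeparation (Δ.stanleyReisnerIdeal K) i J

end PreAbstractSimplicialComplex

end

/-! ### Ideals generated by the squarefree monomials of non-faces -/

/-! Membership in a Stanley–Reisner ideal I is tested face by face (`mem_nonfaceIdeal_iff`): f lies
in I iff, for every face F, setting the variables outside F to zero kills f. Thus S/I embeds in a
product of domains.

Rigidity is linear. Flatness over K[ε] means that ε annihilates only multiples of ε, so the
deformations of S/I are exactly the ideals `deformationIdeal φ` with φ in Hom(I, S/I). A
trivializing automorphism need not fix ε or be the identity modulo ε, but since S is a domain it
maps ε to a unit multiple of ε, and a derivation inducing φ can be read off. Hence rigid means T¹ =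
0 (`isRigidQuotient_of_surjective`, `surjective_of_isRigidQuotient`), which implies ∅-rigid.

Suppose one of the complexes, with vertex set A, is not a simplex. Take a minimal non-face N of it,
v in N, and a vertex w outside A. Splitting v into two vertices, one for each side of the union,
gives a separation (`isSeparation_nonfaceIdeal_splitFaces`). Infinitesimally, "∂/∂x_v on the side
away from A, zero on A" is a homomorphism of degree -e_v. A derivation D inducing it would need D
x_v to have constant term 1 because of x_v x_w, and 0 because of x_N
(`pderivRestrictHom_notMem_range`).

If both are simplices, I is generated by the products x_a x_b with a in A, b outside A. In a
separation each such product with a = v keeps x_v or takes y; mixing the two choices would put a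
product x_b x_b' of variables of the other simplex in I, and otherwise one of x_v, y divides no
minimal generator (`not_isSeparation_nonfaceIdeal_compl`). If some side has two vertices, the
syzygies among the x_a x_b make every homomorphism come from a derivation
(`surjective_derivationToHom_nonfaceIdeal_compl`). For two points, x_a x_b ↦ 1 does not
(`divMonomialHom_notMem_range`). -/

namespace MvPolynomial

variable (K : Type*) [Field K] {W : Type*}

open Classical in
/-- The endomorphism of the polynomial ring that sets the variables outside `F` to zero. -/
noncomputable def restrictVars (F : Set W) : MvPolynomial W K →ₐ[K] MvPolynomial W K :=
  aeval fun i => if i ∈ F then X i else 0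

variable {K}

theorem restrictVars_X_of_mem {F : Set W} {i : W} (h : i ∈ F) : restrictVars K F (X i) = X i := by
  simp [restrictVars, h]

theorem restrictVars_X_of_notMem {F : Set W} {i : W} (h : i ∉ F) :
    restrictVars K F (X i) = 0 := by
  simp [restrictVars, h]

theorem restrictVars_monomial_of_subset {F : Set W} {m : W →₀ ℕ} (a : K)
    (h : ↑m.support ⊆ F) : restrictVars K F (monomial m a) = monomial m a := by
  rw [restrictVars, aeval_monomial, monomial_eq, algebraMap_eq]
  congr 1
  refine Finset.prod_congr rfl fun i hi => ?_
  simp only [if_pos (h hi)]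

theorem restrictVars_monomial_of_not_subset {F : Set W} {m : W →₀ ℕ} (a : K)
    (h : ¬ ↑m.support ⊆ F) : restrictVars K F (monomial m a) = 0 := by
  obtain ⟨i, hi, hiF⟩ := Set.not_subset.1 h
  rw [restrictVars, aeval_monomial]
  refine mul_eq_zero_of_right _ (Finset.prod_eq_zero hi ?_)
  simp only [if_neg hiF]
  exact zero_pow (Finsupp.mem_support_iff.1 hi)

open Classical in
theorem coeff_restrictVars (F : Set W) (f : MvPolynomial W K) (m : W →₀ ℕ) :
    coeff m (restrictVars K F f) = if ↑m.support ⊆ F then coeff m f else 0 := by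
  induction f using MvPolynomial.induction_on' with
  | monomial u a =>
    by_cases h : ↑u.support ⊆ F
    · rw [restrictVars_monomial_of_subset a h, coeff_monomial]
      grind
    · rw [restrictVars_monomial_of_not_subset a h, coeff_monomial, coeff_zero]
      grind
  | add p q hp hq =>
    rw [map_add, coeff_add, coeff_add, hp, hq]
    split_ifs <;> simp

theorem restrictVars_eq_zero_iff {F : Set W} {f : MvPolynomial W K} :
    restrictVars K F f = 0 ↔ ∀ m ∈ f.support, ¬ ↑m.support ⊆ F := by
  constructor
  · intro h m hm hF
    have := congrArg (coeff m) h
    rw [coeff_restrictVars, if_pos hF] at this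
    exact mem_support_iff.1 hm this
  · intro h
    ext m
    rw [coeff_restrictVars, coeff_zero]
    split_ifs with hF
    · by_contra hm
      exact h m (mem_support_iff.2 hm) hF
    · rfl

theorem restrictVars_restrictVars (F G : Set W) (f : MvPolynomial W K) :
    restrictVars K F (restrictVars K G f) = restrictVars K (F ∩ G) f := by
  ext m
  simp only [coeff_restrictVars, Set.subset_inter_iff]
  grind

theorem constantCoeff_restrictVars (F : Set W) (f : MvPolynomial W K) :
    constantCoeff (restrictVars K F f) = constantCoeff f := by
  simp [constantCoeff_eq, coeff_restrictVars]

open Classical in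
theorem restrictVars_empty (f : MvPolynomial W K) :
    restrictVars K ∅ f = C (constantCoeff f) := by
  ext m
  rw [coeff_restrictVars, coeff_C, constantCoeff_eq]
  by_cases h : m = 0
  · simp [h]
  · rw [if_neg (by simpa using h), if_neg (Ne.symm h)]

/-- The exponent vector of the squarefree monomial on `N`. -/
noncomputable def squarefreeExponent (N : Finset W) : W →₀ ℕ := ∑ i ∈ N, Finsupp.single i 1

open Classical in
theorem squarefreeExponent_apply (N : Finset W) (i : W) :
    squarefreeExponent N i = if i ∈ N then 1 else 0 := by
  simp [squarefreeExponent, Finsupp.finsetSum_apply, Finsupp.single_apply]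

theorem support_squarefreeExponent (N : Finset W) : (squarefreeExponent N).support = N := by
  ext i
  simp [squarefreeExponent_apply]

theorem monomial_squarefreeExponent (N : Finset W) :
    monomial (squarefreeExponent N) (1 : K) = ∏ i ∈ N, X i :=
  monomial_sum_one _ _

variable (K) in
/-- The ideal generated by the squarefree monomials whose support is contained in no member of the
family `𝓕`: the Stanley–Reisner ideal of the simplicial complex generated by `𝓕`. -/
noncomputable def nonfaceIdeal (𝓕 : Set (Set W)) : Ideal (MvPolynomial W K) :=
  Ideal.span {f | ∃ N : Finset W, (∀ F ∈ 𝓕, ¬ ↑N ⊆ F) ∧ f = ∏ i ∈ N, X i}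

theorem prod_X_mem_nonfaceIdeal {𝓕 : Set (Set W)} {N : Finset W} (hN : ∀ F ∈ 𝓕, ¬ ↑N ⊆ F) :
    ∏ i ∈ N, X i ∈ nonfaceIdeal K 𝓕 :=
  Ideal.subset_span ⟨N, hN, rfl⟩

theorem nonfaceIdeal_eq_span_monomial (𝓕 : Set (Set W)) :
    nonfaceIdeal K 𝓕 = Ideal.span ((fun u => monomial u (1 : K)) ''
      (squarefreeExponent '' {N : Finset W | ∀ F ∈ 𝓕, ¬ ↑N ⊆ F})) := by
  rw [nonfaceIdeal]
  congr 1
  ext f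
  simp only [Set.image_image, monomial_squarefreeExponent]
  grind

theorem mem_nonfaceIdeal_iff_support {𝓕 : Set (Set W)} {f : MvPolynomial W K} :
    f ∈ nonfaceIdeal K 𝓕 ↔ ∀ m ∈ f.support, ∀ F ∈ 𝓕, ¬ ↑m.support ⊆ F := by
  rw [nonfaceIdeal_eq_span_monomial, mem_ideal_span_monomial_image]
  refine forall₂_congr fun m _ => ⟨?_, fun h => ?_⟩
  · rintro ⟨_, ⟨N, hN, rfl⟩, hle⟩ F hF hm
    refine hN F hF (subset_trans ?_ hm)
    rw [← support_squarefreeExponent N]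
    exact_mod_cast Finsupp.support_mono hle
  · refine ⟨_, ⟨m.support, h, rfl⟩, fun i => ?_⟩
    rw [squarefreeExponent_apply]
    split_ifs with hi
    · exact Nat.one_le_iff_ne_zero.2 (Finsupp.mem_support_iff.1 hi)
    · exact Nat.zero_le _

/-- A monomial survives restriction to F exactly when its support lies in F, and membership in a
monomial ideal is decided monomial by monomial. Restrictions take values in a domain, so factors can
be cancelled on each F separately. -/
theorem mem_nonfaceIdeal_iff {𝓕 : Set (Set W)} {f : MvPolynomial W K} :
    f ∈ nonfaceIdeal K 𝓕 ↔ ∀ F ∈ 𝓕, restrictVars K F f = 0 := by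
  rw [mem_nonfaceIdeal_iff_support]
  simp only [restrictVars_eq_zero_iff]
  grind

theorem monomial_mem_nonfaceIdeal_iff {𝓕 : Set (Set W)} {m : W →₀ ℕ} :
    monomial m (1 : K) ∈ nonfaceIdeal K 𝓕 ↔ ∀ F ∈ 𝓕, ¬ ↑m.support ⊆ F := by
  classical
  rw [mem_nonfaceIdeal_iff_support, support_monomial, if_neg one_ne_zero]
  simp

theorem nonfaceIdeal_congr {𝓕 𝓖 : Set (Set W)}
    (h : ∀ N : Finset W, (∃ F ∈ 𝓕, ↑N ⊆ F) ↔ ∃ G ∈ 𝓖, ↑N ⊆ G) :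
    nonfaceIdeal K 𝓕 = nonfaceIdeal K 𝓖 := by
  ext f
  rw [mem_nonfaceIdeal_iff_support, mem_nonfaceIdeal_iff_support]
  refine forall₂_congr fun m _ => ?_
  simpa only [not_exists, not_and] using not_congr (h m.support)

theorem isMonomialIdeal_nonfaceIdeal (𝓕 : Set (Set W)) : IsMonomialIdeal (nonfaceIdeal K 𝓕) :=
  ⟨_, nonfaceIdeal_eq_span_monomial 𝓕⟩

theorem isMinimalGenerator_squarefreeExponent {𝓕 : Set (Set W)} {N : Finset W}
    (hN : ∀ F ∈ 𝓕, ¬ ↑N ⊆ F) (hmin : ∀ i ∈ N, ∃ F ∈ 𝓕, (N : Set W) \ {i} ⊆ F) :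
    IsMinimalGenerator (nonfaceIdeal K 𝓕) (squarefreeExponent N) := by
  refine ⟨?_, fun u hu hle i => ?_⟩
  · refine monomial_mem_nonfaceIdeal_iff.2 ?_
    rwa [support_squarefreeExponent]
  · replace hu := monomial_mem_nonfaceIdeal_iff.1 hu
    rw [squarefreeExponent_apply]
    split_ifs with hi
    · by_contra hui
      obtain ⟨F, hF, hNF⟩ := hmin i hi
      refine hu F hF fun j hj => hNF ⟨?_, ?_⟩
      · have := Finsupp.support_mono hle hj
        rwa [support_squarefreeExponent] at this
      · rintro rfl
        exact Finsupp.mem_support_iff.1 hj (by omega)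
    · exact Nat.zero_le _

end MvPolynomial

/-! ### Stanley–Reisner ideals as non-face ideals -/

namespace PreAbstractSimplicialComplex

open MvPolynomial

variable (K : Type*) [Field K] {V : Type*}

/-- The faces of a complex as sets, including the empty face. -/
def faceSets (Δ : PreAbstractSimplicialComplex V) : Set (Set V) :=
  insert ∅ ((fun F : Finset V => (F : Set V)) '' Δ.faces)

theorem exists_mem_faceSets_iff (Δ : PreAbstractSimplicialComplex V) (N : Finset V) :
    (∃ F ∈ Δ.faceSets, ↑N ⊆ F) ↔ N = ∅ ∨ N ∈ Δ.faces := by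
  constructor
  · rintro ⟨F, rfl | ⟨F, hF, rfl⟩, hN⟩
    · left
      simpa using hN
    · rcases N.eq_empty_or_nonempty with h | h
      · exact Or.inl h
      · exact Or.inr ((Δ.isRelLowerSet_faces hF).2 (by exact_mod_cast hN) h)
  · rintro (rfl | h)
    · exact ⟨∅, Or.inl rfl, by simp⟩
    · exact ⟨N, Or.inr ⟨N, h, rfl⟩, subset_rfl⟩

/-- Having ∅ among the face sets accounts for the condition `N.Nonempty` on the generators. -/
theorem stanleyReisnerIdeal_eq_nonfaceIdeal (Δ : PreAbstractSimplicialComplex V) :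
    Δ.stanleyReisnerIdeal K = nonfaceIdeal K Δ.faceSets := by
  rw [stanleyReisnerIdeal, nonfaceIdeal]
  congr 1
  ext f
  refine exists_congr fun N => ?_
  have := Δ.exists_mem_faceSets_iff N
  rw [Finset.nonempty_iff_ne_empty, ← and_assoc]
  refine and_congr_left fun _ => ?_
  grind

end PreAbstractSimplicialComplex

/-! ### Flatness over the dual numbers -/

section Flat

open TensorProduct

theorem TensorProduct.exists_eq_tmul_of_span_singleton {R M : Type*} [CommRing R] [AddCommGroup M]
    [Module R M] (a : R) (t : Ideal.span {a} ⊗[R] M) :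
    ∃ m : M, t = (⟨a, Ideal.mem_span_singleton_self a⟩ : Ideal.span {a}) ⊗ₜ[R] m := by
  induction t using TensorProduct.induction_on with
  | zero => exact ⟨0, by simp⟩
  | tmul x y =>
    obtain ⟨c, hc⟩ := Ideal.mem_span_singleton'.1 x.2
    refine ⟨c • y, ?_⟩
    rw [← TensorProduct.smul_tmul]
    congr 1
    exact Subtype.ext hc.symm
  | add x y hx hy =>
    obtain ⟨m, rfl⟩ := hx
    obtain ⟨n, rfl⟩ := hy
    exact ⟨m + n, by rw [TensorProduct.tmul_add]⟩

variable {K : Type*} [Field K] {M : Type*} [AddCommGroup M] [Module K[ε] M]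

theorem DualNumber.exists_eq_span_singleton (I : Ideal K[ε]) :
    ∃ a : K[ε], I = Ideal.span {a} ∧ (a = 0 ∨ a = ε ∨ a = 1) := by
  rcases DualNumber.ideal_trichotomy I with rfl | rfl | rfl
  · exact ⟨0, by simp, Or.inl rfl⟩
  · exact ⟨ε, rfl, Or.inr (Or.inl rfl)⟩
  · exact ⟨1, by simp, Or.inr (Or.inr rfl)⟩

theorem DualNumber.exists_eq_eps_mul_of_eps_mul_eq_zero {a : K[ε]} (h : (ε : K[ε]) * a = 0) :
    ∃ c : K[ε], a = ε * c := by
  refine ⟨TrivSqZeroExt.inl a.snd, ?_⟩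
  have := congrArg TrivSqZeroExt.snd h
  ext
  · simpa using this
  · simp

/-- By the equational criterion the relation εm = 0 is trivial: m is a combination of elements whose
coefficients are killed by ε, hence divisible by ε. -/
theorem Module.Flat.exists_eq_eps_smul [Module.Flat K[ε] M] {m : M} (h : (ε : K[ε]) • m = 0) :
    ∃ m' : M, m = (ε : K[ε]) • m' := by
  have hrel : ∑ i : Unit, (fun _ => (ε : K[ε])) i • (fun _ => m) i = 0 := by simpa using h
  obtain ⟨k, a, y, hm, ha⟩ := Module.Flat.isTrivialRelation_of_sum_smul_eq_zero hrel
  have hc : ∀ j, ∃ c : K[ε], a () j = ε * c := fun j =>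
    DualNumber.exists_eq_eps_mul_of_eps_mul_eq_zero (by simpa using ha j)
  choose c hc using hc
  refine ⟨∑ j, c j • y j, ?_⟩
  rw [Finset.smul_sum]
  refine (hm ()).trans (Finset.sum_congr rfl fun j _ => ?_)
  rw [hc, mul_smul]

/-- Only the ideal (ε) needs checking, and there every tensor is ε ⊗ m. If εm = 0, then m = εm' and
ε ⊗ εm' = ε² ⊗ m' = 0. -/
theorem Module.Flat.of_forall_exists_eq_eps_smul
    (h : ∀ m : M, (ε : K[ε]) • m = 0 → ∃ m' : M, m = (ε : K[ε]) • m') :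
    Module.Flat K[ε] M := by
  rw [Module.Flat.iff_lift_lsmul_comp_subtype_injective]
  intro I _
  obtain ⟨a, rfl, ha⟩ := DualNumber.exists_eq_span_singleton I
  refine (injective_iff_map_eq_zero _).2 fun t ht => ?_
  obtain ⟨m, rfl⟩ := TensorProduct.exists_eq_tmul_of_span_singleton a t
  replace ht : a • m = 0 := by simpa using ht
  rcases ha with rfl | rfl | rfl
  · exact TensorProduct.zero_tmul _ _
  · obtain ⟨m', rfl⟩ := h m ht
    have h0 : (ε : K[ε]) • (⟨ε, Ideal.mem_span_singleton_self ε⟩ : Ideal.span {(ε : K[ε])}) = 0 :=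
      Subtype.ext (by simp)
    rw [← TensorProduct.smul_tmul, h0, TensorProduct.zero_tmul]
  · rw [one_smul] at ht
    rw [ht, TensorProduct.tmul_zero]

end Flat

/-! ### Infinitesimal deformations and the cotangent module -/

section Deformation

variable {K S : Type*} [Field K] [CommRing S] [Algebra K S]

theorem dualNumberInclusion_eps : dualNumberInclusion K S ε = ε := by
  simp [dualNumberInclusion]

theorem RingHom.flat_dualNumber_iff {T : Type*} [CommRing T] (f : K[ε] →+* T) :
    f.Flat ↔ ∀ t : T, f ε * t = 0 → ∃ t' : T, t = f ε * t' := by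
  let _ : Algebra K[ε] T := f.toAlgebra
  refine ⟨fun h t ht => ?_, fun h => ?_⟩
  · have : Module.Flat K[ε] T := h
    exact Module.Flat.exists_eq_eps_smul (K := K) (m := t) ht
  · exact Module.Flat.of_forall_exists_eq_eps_smul (K := K) (M := T) h

theorem flat_quotient_dualNumber_iff (J : Ideal S[ε]) :
    RingHom.Flat (R := K[ε]) (S := S[ε] ⧸ J)
      ((Ideal.Quotient.mk J).comp (dualNumberInclusion K S).toRingHom) ↔
    ∀ z : S[ε], ε * z ∈ J → ∃ w : S[ε], z - ε * w ∈ J := by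
  rw [RingHom.flat_dualNumber_iff, Ideal.Quotient.mk_surjective.forall]
  have heps : ((Ideal.Quotient.mk J).comp (dualNumberInclusion K S).toRingHom) ε =
      Ideal.Quotient.mk J ε := congrArg (Ideal.Quotient.mk J) dualNumberInclusion_eps
  refine forall_congr' fun z => ?_
  rw [heps, Ideal.Quotient.mk_surjective.exists]
  simp only [← map_mul, Ideal.Quotient.eq_zero_iff_mem, Ideal.Quotient.eq]

theorem Ideal.mem_map_algEquiv_iff {A : Type*} [CommRing A] [Algebra K A] {σ : A ≃ₐ[K] A}
    {J : Ideal A} {z : A} : z ∈ J.map σ ↔ σ.symm z ∈ J := by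
  rw [Ideal.mem_map_iff_of_surjective _ σ.surjective]
  constructor
  · rintro ⟨w, hw, rfl⟩
    simpa using hw
  · intro h
    exact ⟨_, h, by simp⟩

theorem mem_map_fstHom_iff {J : Ideal S[ε]} {f : S} :
    f ∈ J.map (TrivSqZeroExt.fstHom S S S) ↔ ∃ z ∈ J, z.fst = f := by
  refine Ideal.mem_map_iff_of_surjective _ fun s => ⟨TrivSqZeroExt.inl s, ?_⟩
  simp

theorem mem_map_algebraMap_dualNumber_iff {I : Ideal S} {z : S[ε]} :
    z ∈ I.map (algebraMap S S[ε]) ↔ z.fst ∈ I ∧ z.snd ∈ I := by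
  constructor
  · intro hz
    induction hz using Submodule.span_induction with
    | mem x hx =>
      obtain ⟨s, hs, rfl⟩ := hx
      exact ⟨by simpa [TrivSqZeroExt.algebraMap_eq_inl] using hs,
        by simp [TrivSqZeroExt.algebraMap_eq_inl]⟩
    | zero => simp
    | add x y _ _ hx hy => exact ⟨I.add_mem hx.1 hy.1, I.add_mem hx.2 hy.2⟩
    | smul a x _ hx =>
      refine ⟨by simpa using I.mul_mem_left _ hx.1, ?_⟩
      simpa using I.add_mem (I.mul_mem_left _ hx.2) (I.mul_mem_left _ hx.1)
  · rintro ⟨h₁, h₂⟩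
    have : z = algebraMap S S[ε] z.fst + ε * algebraMap S S[ε] z.snd := by
      ext <;> simp [TrivSqZeroExt.algebraMap_eq_inl]
    rw [this]
    exact add_mem (Ideal.mem_map_of_mem _ h₁) (Ideal.mul_mem_left _ _ (Ideal.mem_map_of_mem _ h₂))

/-- The ideal of `S[ε]` that consists of the `f + gε` with `f ∈ I` and `g` a representative
of `φ f`. -/
def deformationIdeal {I : Ideal S} (φ : I →ₗ[S] S ⧸ I) : Ideal S[ε] where
  carrier := {z | ∃ h : z.fst ∈ I, Ideal.Quotient.mk I z.snd = φ ⟨z.fst, h⟩}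
  add_mem' := by
    rintro z w ⟨hz, hz'⟩ ⟨hw, hw'⟩
    refine ⟨I.add_mem hz hw, ?_⟩
    rw [TrivSqZeroExt.snd_add, map_add, hz', hw', ← map_add]
    rfl
  zero_mem' := ⟨I.zero_mem, by
    rw [TrivSqZeroExt.snd_zero, map_zero]
    exact (map_zero φ).symm⟩
  smul_mem' := by
    rintro a z ⟨hz, hz'⟩
    refine ⟨by simpa using I.mul_mem_left _ hz, ?_⟩
    have h : (⟨(a • z).fst, by simpa using I.mul_mem_left _ hz⟩ : I) =
        a.fst • (⟨z.fst, hz⟩ : I) := Subtype.ext (by simp)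
    rw [h, map_smul, ← hz', Algebra.smul_def, Ideal.Quotient.algebraMap_eq, ← map_mul,
      Ideal.Quotient.eq]
    simpa using I.mul_mem_left _ hz

theorem mem_deformationIdeal_iff {I : Ideal S} {φ : I →ₗ[S] S ⧸ I} {z : S[ε]} :
    z ∈ deformationIdeal φ ↔ ∃ h : z.fst ∈ I, Ideal.Quotient.mk I z.snd = φ ⟨z.fst, h⟩ :=
  Iff.rfl

variable (K) in
theorem isInfinitesimalDeformation_deformationIdeal {I : Ideal S} (φ : I →ₗ[S] S ⧸ I) :
    IsInfinitesimalDeformation K I (deformationIdeal φ) := by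
  have hlift : ∀ (f : S) (hf : f ∈ I), ∃ z ∈ deformationIdeal φ, z.fst = f := by
    intro f hf
    obtain ⟨g, hg⟩ := Ideal.Quotient.mk_surjective (φ ⟨f, hf⟩)
    exact ⟨TrivSqZeroExt.inl f + TrivSqZeroExt.inr g, ⟨by simpa using hf, by simpa using hg⟩,
      by simp⟩
  refine ⟨(flat_quotient_dualNumber_iff _).2 fun z ⟨hz, hz'⟩ => ?_, ?_⟩
  · have hfst : z.fst ∈ I := by
      rw [← Ideal.Quotient.eq_zero_iff_mem]
      have h0 : (⟨(ε * z : S[ε]).fst, hz⟩ : I) = 0 := Subtype.ext (by simp)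
      rw [h0, map_zero] at hz'
      simpa using hz'
    obtain ⟨w, hw, hwz⟩ := hlift _ hfst
    -- With this multiple of ε subtracted, z becomes the lift w of its own first component.
    refine ⟨TrivSqZeroExt.inl (z.snd - w.snd), ?_⟩
    convert hw using 1
    ext <;> simp [hwz]
  · ext f
    rw [mem_map_fstHom_iff]
    exact ⟨fun ⟨z, hz, h⟩ => h ▸ hz.1, hlift f⟩

/-- The homomorphism sends f to the ε-coefficient of any lift of f to J. Flatness makes it well
defined modulo I: if ε(g - g') lies in J, then g - g' lies in I. -/
theorem IsInfinitesimalDeformation.exists_eq_deformationIdeal {I : Ideal S} {J : Ideal S[ε]}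
    (hJ : IsInfinitesimalDeformation K I J) :
    ∃ φ : I →ₗ[S] S ⧸ I, J = deformationIdeal φ := by
  obtain ⟨hflat, hmap⟩ := hJ
  rw [flat_quotient_dualNumber_iff] at hflat
  have hfst : ∀ z ∈ J, z.fst ∈ I := fun z hz => hmap ▸ mem_map_fstHom_iff.2 ⟨z, hz, rfl⟩
  have hlift : ∀ f : I, ∃ z ∈ J, z.fst = (f : S) := fun f =>
    mem_map_fstHom_iff.1 (hmap.symm ▸ f.2)
  have huniq : ∀ z ∈ J, ∀ w ∈ J, z.fst = w.fst →
      Ideal.Quotient.mk I z.snd = Ideal.Quotient.mk I w.snd := by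
    intro z hz w hw h
    have hsub : z - w = ε * TrivSqZeroExt.inl (z.snd - w.snd) := by
      ext <;> simp [h]
    obtain ⟨t, ht⟩ := hflat _ (hsub ▸ J.sub_mem hz hw)
    rw [Ideal.Quotient.eq]
    simpa using hfst _ ht
  choose lift hliftJ hliftfst using hlift
  let φ : I →ₗ[S] S ⧸ I :=
    { toFun := fun f => Ideal.Quotient.mk I (lift f).snd
      map_add' := fun f g => by
        rw [← map_add, ← TrivSqZeroExt.snd_add]
        exact huniq _ (hliftJ _) _ (J.add_mem (hliftJ _) (hliftJ _)) (by simp [hliftfst])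
      map_smul' := fun r f => by
        rw [RingHom.id_apply, Algebra.smul_def, Ideal.Quotient.algebraMap_eq, ← map_mul]
        have := huniq _ (hliftJ (r • f)) (TrivSqZeroExt.inl r * lift f)
          (J.mul_mem_left _ (hliftJ _)) (by simp [hliftfst])
        simpa using this }
  refine ⟨φ, ?_⟩
  ext z
  constructor
  · intro hz
    exact ⟨hfst z hz, huniq _ hz _ (hliftJ _) (by simp [hliftfst])⟩
  · rintro ⟨hz, hz'⟩
    have hsnd : z.snd - (lift ⟨z.fst, hz⟩).snd ∈ I := Ideal.Quotient.eq.1 hz'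
    obtain ⟨t, htJ, ht⟩ := mem_map_fstHom_iff.1 (hmap.ge hsnd)
    have hsub : z = lift ⟨z.fst, hz⟩ + ε * t := by
      ext <;> simp [hliftfst, ht]
    rw [hsub]
    exact J.add_mem (hliftJ _) (J.mul_mem_left _ htJ)

/-- The automorphism `s + tε ↦ s + (t + D s)ε` of `S[ε]` given by a derivation `D`. -/
def dualNumberEquivOfDerivation (D : Derivation K S S) : S[ε] ≃ₐ[K] S[ε] where
  toFun z := TrivSqZeroExt.inl z.fst + TrivSqZeroExt.inr (z.snd + D z.fst)
  invFun z := TrivSqZeroExt.inl z.fst + TrivSqZeroExt.inr (z.snd - D z.fst)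
  left_inv z := by ext <;> simp
  right_inv z := by ext <;> simp
  map_add' z w := by
    ext
    · simp
    · simp
      ring
  map_mul' z w := by
    ext
    · simp
    · simp
      ring
  commutes' r := by
    ext <;> simp [TrivSqZeroExt.algebraMap_eq_inl']

/-- If φ is induced by D, the automorphism s + tε ↦ s + (t + D s)ε carries I S[ε] onto
`deformationIdeal φ`. -/
theorem isRigidQuotient_of_surjective {I : Ideal S}
    (h : Function.Surjective (derivationToHom K I)) : IsRigidQuotient K I := by
  intro J hJ
  obtain ⟨φ, rfl⟩ := hJ.exists_eq_deformationIdeal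
  obtain ⟨D, rfl⟩ := h φ
  refine ⟨(dualNumberEquivOfDerivation D).symm, ?_⟩
  ext z
  rw [mem_map_algebraMap_dualNumber_iff]
  rw [Ideal.mem_map_algEquiv_iff, AlgEquiv.symm_symm, mem_deformationIdeal_iff]
  have hfst : (dualNumberEquivOfDerivation D z).fst = z.fst := by
    simp [dualNumberEquivOfDerivation]
  have hsnd : (dualNumberEquivOfDerivation D z).snd = z.snd + D z.fst := by
    simp [dualNumberEquivOfDerivation]
  have key : ∀ hz : z.fst ∈ I, Ideal.Quotient.mk I (dualNumberEquivOfDerivation D z).snd =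
      derivationToHom K I D ⟨z.fst, hz⟩ ↔ z.snd ∈ I := by
    intro hz
    rw [hsnd]
    change Ideal.Quotient.mk I _ = Ideal.Quotient.mk I _ ↔ _
    rw [Ideal.Quotient.eq, add_sub_cancel_right]
  constructor
  · rintro ⟨hz, hz'⟩
    have hzI : z.fst ∈ I := by rwa [hfst] at hz
    refine ⟨hzI, (key hzI).1 (hz'.trans ?_)⟩
    congr 1
    exact Subtype.ext hfst
  · rintro ⟨hz, hz'⟩
    refine ⟨by rwa [hfst], ((key hz).2 hz').trans ?_⟩
    congr 1
    exact Subtype.ext hfst.symm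

theorem fst_algEquiv_eps [IsDomain S] (σ : S[ε] ≃ₐ[K] S[ε]) : (σ ε).fst = 0 := by
  have h : σ ε * σ ε = 0 := by rw [← map_mul, DualNumber.eps_mul_eps, map_zero]
  simpa using congrArg TrivSqZeroExt.fst h

theorem fst_algEquiv_apply [IsDomain S] (σ : S[ε] ≃ₐ[K] S[ε]) (z : S[ε]) :
    (σ z).fst = (σ (TrivSqZeroExt.inl z.fst)).fst := by
  have hz : z = TrivSqZeroExt.inl z.fst + TrivSqZeroExt.inl z.snd * ε := by
    ext <;> simp
  conv_lhs => rw [hz]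
  simp [fst_algEquiv_eps]

theorem fst_algEquiv_symm_fst [IsDomain S] (σ : S[ε] ≃ₐ[K] S[ε]) (s : S) :
    (σ.symm (TrivSqZeroExt.inl (σ (TrivSqZeroExt.inl s)).fst)).fst = s := by
  rw [← fst_algEquiv_apply]
  simp

/-- An automorphism `σ` of `S[ε]` induces an automorphism `τ` of `S`, and `s ↦ τ⁻¹ t` with
`σ s = τ s + tε` is a derivation. -/
def derivationOfDualNumberEquiv [IsDomain S] (σ : S[ε] ≃ₐ[K] S[ε]) : Derivation K S S :=
  Derivation.mk'
    { toFun := fun s =>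
        (σ.symm (TrivSqZeroExt.inl (σ (TrivSqZeroExt.inl s)).snd)).fst
      map_add' := fun s t => by simp
      map_smul' := fun r s => by
        have : (TrivSqZeroExt.inl (r • s) : S[ε]) = r • TrivSqZeroExt.inl s := by
          ext <;> simp
        rw [this, map_smul, TrivSqZeroExt.snd_smul]
        have : ∀ t : S, (TrivSqZeroExt.inl (r • t) : S[ε]) = r • TrivSqZeroExt.inl t := by
          intro t
          ext <;> simp
        rw [this, map_smul, TrivSqZeroExt.fst_smul, RingHom.id_apply] } fun s t => by
    have h : ∀ s t : S, (TrivSqZeroExt.inl (s * t) : S[ε]) =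
        TrivSqZeroExt.inl s * TrivSqZeroExt.inl t := fun s t => by simp
    simp only [LinearMap.coe_mk, AddHom.coe_mk]
    rw [h, map_mul, TrivSqZeroExt.snd_mul]
    simp only [smul_eq_mul, MulOpposite.smul_eq_mul_unop, MulOpposite.unop_op,
      TrivSqZeroExt.inl_add, h, map_add, map_mul, TrivSqZeroExt.fst_add, TrivSqZeroExt.fst_mul,
      fst_algEquiv_symm_fst]
    ring

/-- Let τ be the automorphism of S induced by σ, and D the derivation extracted from σ. For f + gε
in the deformation, the ε-coefficient of its image under σ lies in I. Applying τ⁻¹, which maps I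
into itself, gives D f + g u ∈ I with u a unit; so -u⁻¹D induces φ. -/
theorem surjective_of_isRigidQuotient [IsDomain S] {I : Ideal S} (h : IsRigidQuotient K I) :
    Function.Surjective (derivationToHom K I) := by
  intro φ
  obtain ⟨σ, hσ⟩ := h _ (isInfinitesimalDeformation_deformationIdeal K φ)
  have hmem : ∀ z, z ∈ deformationIdeal φ ↔ (σ z).fst ∈ I ∧ (σ z).snd ∈ I := by
    intro z
    rw [← mem_map_algebraMap_dualNumber_iff, ← hσ, Ideal.mem_map_algEquiv_iff,
      AlgEquiv.symm_apply_apply]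
  -- the automorphism of `S` induced by `σ.symm` preserves `I`
  have hI : ∀ s ∈ I, (σ.symm (TrivSqZeroExt.inl s)).fst ∈ I := fun s hs =>
    ((hmem (σ.symm (TrivSqZeroExt.inl s))).2 (by simpa using hs)).1
  set u := (σ.symm (TrivSqZeroExt.inl (σ ε).snd)).fst with hu
  -- `σ` multiplies `ε` by a unit
  have heps : σ ε = ε * TrivSqZeroExt.inl (σ ε).snd := by
    ext <;> simp [fst_algEquiv_eps]
  obtain ⟨c, hc⟩ : ∃ c : S, c * u = 1 := by
    refine ⟨(σ.symm ε).snd, ?_⟩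
    have h1 : (ε : S[ε]) = σ.symm ε * σ.symm (TrivSqZeroExt.inl (σ ε).snd) := by
      rw [← map_mul, ← heps, AlgEquiv.symm_apply_apply]
    have h2 := congrArg TrivSqZeroExt.snd h1
    simpa [fst_algEquiv_eps, ← hu] using h2.symm
  refine ⟨-c • derivationOfDualNumberEquiv σ, ?_⟩
  ext f
  obtain ⟨g, hg⟩ := Ideal.Quotient.mk_surjective (φ f)
  have hz : (TrivSqZeroExt.inl (f : S) + TrivSqZeroExt.inl g * ε : S[ε]) ∈ deformationIdeal φ :=
    ⟨by simp, by simpa using hg⟩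
  have h1 := hI _ ((hmem _).1 hz).2
  have h2 : derivationOfDualNumberEquiv σ f + g * u ∈ I := by
    convert h1 using 1
    simp only [map_add, map_mul, TrivSqZeroExt.snd_add, TrivSqZeroExt.snd_mul, fst_algEquiv_eps,
      TrivSqZeroExt.inl_add, TrivSqZeroExt.fst_add, smul_eq_mul, TrivSqZeroExt.inl_mul, add_zero,
      TrivSqZeroExt.fst_mul, fst_algEquiv_symm_fst, MulOpposite.op_zero, zero_smul]
    rfl
  rw [← hg]
  change Ideal.Quotient.mk I (-c * derivationOfDualNumberEquiv σ f) = _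
  rw [Ideal.Quotient.eq]
  convert I.mul_mem_left (-c) h2 using 1
  linear_combination g * hc

end Deformation

/-! ### The union of two disjoint simplices -/

namespace MvPolynomial

variable {K : Type*} [Field K] {W : Type*}

theorem X_mul_X_mem_nonfaceIdeal_compl {A : Set W} {a b : W} (ha : a ∈ A) (hb : b ∉ A) :
    X a * X b ∈ nonfaceIdeal K {A, Aᶜ} := by
  rw [mem_nonfaceIdeal_iff]
  rintro F (rfl | rfl)
  · rw [map_mul, restrictVars_X_of_notMem hb, mul_zero]
  · rw [map_mul, restrictVars_X_of_notMem (by simpa using ha), zero_mul]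

theorem nonfaceIdeal_compl_eq_span (A : Set W) :
    nonfaceIdeal K {A, Aᶜ} = Ideal.span {f | ∃ a ∈ A, ∃ b ∉ A, f = X a * X b} := by
  classical
  apply le_antisymm
  · rw [nonfaceIdeal, Ideal.span_le]
    rintro _ ⟨N, hN, rfl⟩
    obtain ⟨b, hb, hbA⟩ := Set.not_subset.1 (hN A (Or.inl rfl))
    obtain ⟨a, ha, haA⟩ := Set.not_subset.1 (hN Aᶜ (Or.inr rfl))
    rw [Set.notMem_compl_iff] at haA
    have hne : b ≠ a := fun h => hbA (h ▸ haA)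
    rw [← Finset.mul_prod_erase N _ ha, ← Finset.mul_prod_erase _ _
      (Finset.mem_erase.2 ⟨hne, hb⟩), ← mul_assoc]
    exact Ideal.mul_mem_right _ _ (Ideal.subset_span ⟨a, haA, b, hbA, rfl⟩)
  · rw [Ideal.span_le]
    rintro _ ⟨a, ha, b, hb, rfl⟩
    exact X_mul_X_mem_nonfaceIdeal_compl ha hb

/-- Two distinct indices are needed: X a₀ divides X a₁ * g a₀, and being a prime not dividing X a₁
it divides g a₀. -/
theorem exists_eq_X_mul_of_nontrivial {A : Set W} (hA : A.Nontrivial) {g : W → MvPolynomial W K}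
    (hg : ∀ a ∈ A, ∀ a' ∈ A, X a' * g a = X a * g a') : ∃ G, ∀ a ∈ A, g a = X a * G := by
  obtain ⟨a₀, h₀, a₁, h₁, hne⟩ := hA
  have hdvd : X a₀ ∣ X a₁ * g a₀ := ⟨_, hg a₀ h₀ a₁ h₁⟩
  obtain ⟨G, hG⟩ := (X_prime.dvd_or_dvd hdvd).resolve_left fun h => hne (X_dvd_X.1 h)
  refine ⟨G, fun a ha => mul_left_cancel₀ (X_ne_zero a₀) ?_⟩
  rw [hg a ha a₀ h₀, hG]
  ring

theorem X_dvd_restrictVars_singleton {b : W} {f : MvPolynomial W K} (hf : constantCoeff f = 0) :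
    X b ∣ restrictVars K {b} f := by
  classical
  rw [← Ideal.mem_span_singleton, ← Set.image_singleton (f := X), mem_ideal_span_X_image]
  intro m hm
  rw [mem_support_iff, coeff_restrictVars] at hm
  refine ⟨b, rfl, fun hmb => ?_⟩
  have hsub : ↑m.support ⊆ ({b} : Set W) := by
    by_contra h
    exact hm (if_neg h)
  have h0 : m = 0 := by
    ext i
    by_contra hi
    obtain rfl : i = b := hsub (Finsupp.mem_support_iff.2 hi)
    exact hi hmb
  rw [if_pos hsub, h0] at hm
  exact hm hf

theorem surjective_derivationToHom_nonfaceIdeal_compl {A : Set W} (hA : A.Nontrivial) :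
    Function.Surjective (derivationToHom K (nonfaceIdeal K {A, Aᶜ})) := by
  classical
  set I := nonfaceIdeal K {A, Aᶜ} with hI
  intro φ
  have hmem : ∀ {a b}, a ∈ A → b ∉ A → X a * X b ∈ I := X_mul_X_mem_nonfaceIdeal_compl
  have hF : ∀ a b, ∃ f : MvPolynomial W K, ∀ (ha : a ∈ A) (hb : b ∉ A),
      Ideal.Quotient.mk I f = φ ⟨X a * X b, hmem ha hb⟩ := by
    intro a b
    by_cases h : a ∈ A ∧ b ∉ A
    · obtain ⟨f, hf⟩ := Ideal.Quotient.mk_surjective (φ ⟨X a * X b, hmem h.1 h.2⟩)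
      exact ⟨f, fun _ _ => hf⟩
    · exact ⟨0, fun ha hb => absurd ⟨ha, hb⟩ h⟩
  choose F hF using hF
  have hrel : ∀ (c c' : MvPolynomial W K) {a b a' b'} (ha : a ∈ A) (hb : b ∉ A) (ha' : a' ∈ A)
      (hb' : b' ∉ A), c * (X a * X b) = c' * (X a' * X b') → c * F a b - c' * F a' b' ∈ I := by
    intro c c' a b a' b' ha hb ha' hb' h
    have h1 : c • (⟨X a * X b, hmem ha hb⟩ : I) = c' • ⟨X a' * X b', hmem ha' hb'⟩ :=
      Subtype.ext h
    have h2 := congrArg φ h1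
    rw [map_smul, map_smul, ← hF a b ha hb, ← hF a' b' ha' hb'] at h2
    exact Ideal.Quotient.eq.1 h2
  have hres : ∀ {f}, f ∈ I ↔ restrictVars K A f = 0 ∧ restrictVars K Aᶜ f = 0 := by
    intro f
    rw [hI, mem_nonfaceIdeal_iff]
    simp
  -- On A, the syzygy between x_a x_b and x_a' x_b forces F a b to be x_a times a factor depending
  -- only on b.
  have hG : ∀ b, ∃ G, b ∉ A → ∀ a ∈ A, restrictVars K A (F a b) = X a * G := by
    intro b
    by_cases hb : b ∉ A
    · obtain ⟨G, hG⟩ := exists_eq_X_mul_of_nontrivial hA (g := fun a => restrictVars K A (F a b))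
        fun a ha a' ha' => by
          have := (hres.1 (hrel (X a') (X a) ha hb ha' hb (by ring))).1
          simpa [restrictVars_X_of_mem ha, restrictVars_X_of_mem ha', sub_eq_zero] using this
      exact ⟨G, fun _ => hG⟩
    · exact ⟨0, fun h => absurd h hb⟩
  choose G hG using hG
  have hH : ∀ a, ∃ H, a ∈ A → ∀ b ∈ Aᶜ, restrictVars K Aᶜ (F a b) = X b * H := by
    intro a
    by_cases ha : a ∈ A
    · by_cases hA' : Aᶜ.Nontrivial
      · obtain ⟨H, hH⟩ := exists_eq_X_mul_of_nontrivial hA'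
          (g := fun b => restrictVars K Aᶜ (F a b)) fun b hb b' hb' => by
            have := (hres.1 (hrel (X b') (X b) ha hb ha hb' (by ring))).2
            simpa [restrictVars_X_of_mem hb, restrictVars_X_of_mem hb', sub_eq_zero] using this
        exact ⟨H, fun _ => hH⟩
      · rcases (Set.not_nontrivial_iff.1 hA').eq_empty_or_singleton with h | ⟨b, h⟩
        · exact ⟨0, fun _ b hb => by simp [h] at hb⟩
        · have hb : b ∈ Aᶜ := h ▸ rfl
          -- With a single vertex b outside A there is no syzygy to use on that side. The
          -- divisibility already known on A makes the constant term vanish, which suffices in one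
          -- variable.
          have h0 : constantCoeff (F a b) = 0 := by
            rw [← constantCoeff_restrictVars A, hG b hb a ha]
            simp
          obtain ⟨H, hH⟩ := X_dvd_restrictVars_singleton (b := b) h0
          refine ⟨H, fun _ b' hb' => ?_⟩
          rw [h] at hb' ⊢
          obtain rfl : b' = b := hb'
          exact hH
    · exact ⟨0, fun h => absurd h ha⟩
  choose H hH using hH
  -- On x_a x_b this derivation gives x_a G b + x_b H a. Restriction to A keeps the first summand,
  -- restriction to the complement the second.
  refine ⟨mkDerivation K fun i => if i ∈ A then H i else G i, ?_⟩
  rw [Submodule.linearMap_eq_iff_of_eq_span _ _ (nonfaceIdeal_compl_eq_span A)]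
  rintro ⟨_, a, ha, b, hb, rfl⟩
  refine Eq.trans ?_ (hF a b ha hb)
  change Ideal.Quotient.mk I _ = _
  rw [Ideal.Quotient.eq, hres, Derivation.leibniz, mkDerivation_X, mkDerivation_X, if_pos ha,
    if_neg hb]
  have h1 := congrArg (restrictVars K A) (hG b hb a ha)
  have h2 := congrArg (restrictVars K Aᶜ) (hH a ha b hb)
  rw [restrictVars_restrictVars, Set.inter_self] at h1 h2
  have ha' : a ∉ Aᶜ := by simpa using ha
  have hb' : b ∈ Aᶜ := hb
  simp [h1, h2, restrictVars_X_of_notMem ha', restrictVars_X_of_mem hb', restrictVars_X_of_mem ha,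
    restrictVars_X_of_notMem hb]

/-! ### Inseparability of two disjoint simplices -/

/-- The exponents after the substitution `y ↦ x_v`. -/
theorem mapDomain_elim_apply [DecidableEq W] (v : W) (u : Option W →₀ ℕ) (c : W) :
    u.mapDomain (fun o => o.elim v id) c = u (some c) + if c = v then u none else 0 := by
  induction u using Finsupp.induction_linear with
  | zero => simp
  | add f g hf hg =>
    rw [Finsupp.mapDomain_add, Finsupp.add_apply, hf, hg]
    split_ifs <;> simp only [Finsupp.add_apply] <;> ring
  | single o n =>
    rw [Finsupp.mapDomain_single]
    cases o <;> simp [Finsupp.single_apply, eq_comm]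

theorem aeval_elim_eq_rename (v : W) :
    aeval (R := K) (fun o : Option W => o.elim (X v) X) =
      rename (fun o : Option W => o.elim v id) := by
  ext o
  cases o <;> simp

theorem not_isSeparation_nonfaceIdeal_compl {A : Set W} {v : W} (hv : v ∈ A)
    (J : Ideal (MvPolynomial (Option W) K)) :
    ¬ IsSeparation (nonfaceIdeal K {A, Aᶜ}) v J := by
  classical
  rintro ⟨⟨s, hs⟩, hmap, hx, hy, hreg⟩
  rw [aeval_elim_eq_rename] at hmap
  have hne : ∀ {b}, b ∉ A → b ≠ v := fun hb h => hb (h ▸ hv)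
  have hψ : ∀ {f}, f ∈ J → rename (fun o : Option W => o.elim v id) f ∈ nonfaceIdeal K {A, Aᶜ} :=
    fun hf => hmap.le (Ideal.mem_map_of_mem _ hf)
  have hψu : ∀ {u}, monomial u (1 : K) ∈ J → ∃ b ∉ A, u (some b) ≠ 0 := by
    intro u hu
    have := hψ hu
    rw [rename_monomial, monomial_mem_nonfaceIdeal_iff] at this
    obtain ⟨b, hb, hbA⟩ := Set.not_subset.1 (this A (Or.inl rfl))
    refine ⟨b, hbA, fun h => ?_⟩
    have hb := Finsupp.mem_support_iff.1 hb
    rw [mapDomain_elim_apply, if_neg (hne hbA)] at hb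
    exact hb (by simpa using h)
  have hcancel : ∀ {f : MvPolynomial (Option W) K}, (X none - X (some v)) * f ∈ J → f ∈ J := by
    intro f hf
    rw [← Ideal.Quotient.eq_zero_iff_mem] at hf ⊢
    rw [map_mul] at hf
    exact (mul_left_mem_nonZeroDivisors_eq_zero_iff hreg).1 hf
  -- Some monomial of J maps to a divisor of x_v x_b. Its exponents of x_v and y add up to at most
  -- 1, so it divides one of the two products.
  have hpair : ∀ b ∉ A, X (some v) * X (some b) ∈ J ∨ X none * X (some b) ∈ J := by
    intro b hb
    have h1 : X v * X b ∈ nonfaceIdeal K {A, Aᶜ} := X_mul_X_mem_nonfaceIdeal_compl hv hb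
    have hXX : ∀ {T : Type _} (i j : T), (X i * X j : MvPolynomial T K) =
        monomial (Finsupp.single i 1 + Finsupp.single j 1) 1 := by
      intro T i j
      simp [X, monomial_mul]
    rw [← hmap, hs, Ideal.map_span, Set.image_image] at h1
    simp only [rename_monomial] at h1
    rw [← Set.image_image (fun u => monomial u (1 : K)) (Finsupp.mapDomain _) s,
      mem_ideal_span_monomial_image, hXX] at h1
    obtain ⟨_, ⟨u, hu, rfl⟩, hle⟩ := h1 (Finsupp.single v 1 + Finsupp.single b 1) (by simp)
    have huJ : monomial u (1 : K) ∈ J := hs ▸ Ideal.subset_span ⟨u, hu, rfl⟩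
    replace hle : ∀ c, u (some c) + (if c = v then u none else 0) ≤
        (if v = c then 1 else 0) + if b = c then 1 else 0 := by
      intro c
      have := hle c
      rwa [mapDomain_elim_apply, Finsupp.add_apply, Finsupp.single_apply,
        Finsupp.single_apply] at this
    have hv' := hle v
    rw [if_pos rfl, if_pos rfl, if_neg (hne hb)] at hv'
    rw [hXX, hXX]
    by_cases h0 : u none = 0
    · left
      refine Ideal.mem_of_dvd J (monomial_one_dvd_monomial_one.2 fun o => ?_) huJ
      rcases o with _ | c
      · simp [h0]
      · have := hle c
        simp only [Finsupp.add_apply, Finsupp.single_apply, Option.some_inj]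
        grind
    · right
      refine Ideal.mem_of_dvd J (monomial_one_dvd_monomial_one.2 fun o => ?_) huJ
      rcases o with _ | c
      · simp
        omega
      · have := hle c
        simp only [Finsupp.add_apply, Finsupp.single_apply, Option.some_inj]
        grind
  have hexcl : (∀ b ∉ A, X (some v) * X (some b) ∈ J) ∨ ∀ b ∉ A, X none * X (some b) ∈ J := by
    by_contra! ⟨⟨a, ha, ha'⟩, b, hb, hb'⟩
    have h1 := (hpair a ha).resolve_left ha'
    have h2 := (hpair b hb).resolve_right hb'
    -- If y x_a and x_v x_b are in J, so is (y - x_v) x_a x_b, and y - x_v cancels. Here a and b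
    -- both lie outside A, so x_a x_b cannot map into the ideal.
    have h3 : X (some a) * X (some b) ∈ J := by
      apply hcancel
      convert J.sub_mem (J.mul_mem_right (X (some b)) h1) (J.mul_mem_right (X (some a)) h2) using 1
      ring
    have h4 := mem_nonfaceIdeal_iff.1 (hψ h3) Aᶜ (Or.inr rfl)
    rw [map_mul, rename_X, rename_X, map_mul] at h4
    simp only [Option.elim_some, id] at h4
    rw [restrictVars_X_of_mem (show a ∈ Aᶜ from ha), restrictVars_X_of_mem (show b ∈ Aᶜ from hb)]
      at h4
    exact mul_ne_zero (X_ne_zero a) (X_ne_zero b) h4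
  -- If o' divides a minimal generator, remove one factor o'. The remaining monomial still contains
  -- some x_b with b outside A, so its product with X o is in J too; cancelling X o - X o'
  -- contradicts minimality.
  have key : ∀ o o' : Option W, (∀ {f : MvPolynomial (Option W) K}, (X o - X o') * f ∈ J → f ∈ J) →
      (∀ b ∉ A, X o * X (some b) ∈ J) → (∀ b ∉ A, some b ≠ o') →
      ¬ ∃ u, IsMinimalGenerator J u ∧ u o' ≠ 0 := by
    rintro o o' hc ho ho' ⟨u, hu, hu0⟩
    obtain ⟨b, hb, hub⟩ := hψu hu.1
    obtain ⟨w, rfl⟩ : ∃ w, u = w + Finsupp.single o' 1 :=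
      ⟨u - Finsupp.single o' 1, (tsub_add_cancel_of_le
        (Finsupp.single_le_iff.2 (Nat.one_le_iff_ne_zero.2 hu0))).symm⟩
    rw [Finsupp.add_apply, Finsupp.single_apply, if_neg (ho' b hb).symm, add_zero] at hub
    have h1 : X o' * monomial w (1 : K) ∈ J := by
      have : monomial (w + Finsupp.single o' 1) (1 : K) ∈ J := hu.1
      rwa [monomial_add_single, pow_one, mul_comm] at this
    have h2 : X o * monomial w (1 : K) ∈ J := by
      obtain ⟨q, hq⟩ : X (some b) ∣ monomial w (1 : K) := X_dvd_monomial.2 (Or.inr hub)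
      rw [hq, ← mul_assoc]
      exact J.mul_mem_right _ (ho b hb)
    have h3 : monomial w (1 : K) ∈ J := hc (by rw [sub_mul]; exact J.sub_mem h2 h1)
    have h4 := hu.2 h3 le_self_add o'
    simp at h4
  rcases hexcl with h | h
  · refine key (some v) none (fun hf => hcancel ?_) h (fun b _ => by simp) hy
    rw [← neg_mem_iff]
    convert hf using 1
    ring
  · exact key none (some v) hcancel h (fun b hb => by simpa using hne hb) hx

end MvPolynomial

/-! ### Homomorphisms of negative degree that are not induced by derivations -/

namespace MvPolynomial

variable {K : Type*} [Field K] {W : Type*}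

theorem constantCoeff_pderiv (v : W) (f : MvPolynomial W K) :
    constantCoeff (pderiv v f) = coeff (Finsupp.single v 1) f := by
  classical
  induction f using MvPolynomial.induction_on' with
  | monomial u a =>
    rw [pderiv_monomial, constantCoeff_eq, coeff_monomial, coeff_monomial]
    by_cases hu : u = Finsupp.single v 1
    · simp [hu]
    · rw [if_neg hu]
      split_ifs with h
      · suffices u v = 0 by simp [this]
        by_contra hv
        refine hu (le_antisymm (tsub_eq_zero_iff_le.1 h) ?_)
        exact Finsupp.single_le_iff.2 (Nat.one_le_iff_ne_zero.2 hv)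
      · rfl
  | add p q hp hq => rw [map_add, map_add, coeff_add, hp, hq]

theorem mk_monomial_mem_quotientDegree {I : Ideal (MvPolynomial W K)} {d : W → ℤ} {m : W →₀ ℕ}
    (h : ∀ i, (m i : ℤ) = d i) (c : K) :
    Ideal.Quotient.mk I (monomial m c) ∈ quotientDegree I d := by
  have : monomial m c = c • monomial m (1 : K) := by simp [smul_monomial]
  rw [this]
  exact (quotientDegree I d).smul_mem c (Submodule.subset_span ⟨m, h, rfl⟩)

/-! ### A homomorphism of degree -e_v attached to a minimal non-face -/

section Nonface

variable {𝓕 : Set (Set W)} {A : Set W}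

theorem X_mul_X_mem_nonfaceIdeal (h𝓕 : ∀ F ∈ 𝓕, F ⊆ A ∨ F ⊆ Aᶜ) {v w : W} (hv : v ∈ A)
    (hw : w ∉ A) : X v * X w ∈ nonfaceIdeal K 𝓕 := by
  rw [mem_nonfaceIdeal_iff]
  intro F hF
  rw [map_mul]
  rcases h𝓕 F hF with h | h
  · rw [restrictVars_X_of_notMem fun hwF => hw (h hwF), mul_zero]
  · rw [restrictVars_X_of_notMem fun hvF => h hvF hv, zero_mul]

/-- The homomorphism `f ↦ (∂f/∂x_v)|_{x_a = 0, a ∈ A}` on the Stanley–Reisner ideal of a complex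
all of whose faces lie in `A` or in its complement. -/
noncomputable def pderivRestrictHom (h𝓕 : ∀ F ∈ 𝓕, F ⊆ A ∨ F ⊆ Aᶜ) {v : W}
    (hv : ∃ F ∈ 𝓕, v ∈ F) :
    nonfaceIdeal K 𝓕 →ₗ[MvPolynomial W K] MvPolynomial W K ⧸ nonfaceIdeal K 𝓕 where
  toFun f := Ideal.Quotient.mk _ (restrictVars K Aᶜ (pderiv v f))
  map_add' f g := by simp
  map_smul' s f := by
    refine Ideal.Quotient.eq.2 (mem_nonfaceIdeal_iff.2 fun F hF => ?_)
    have hf : restrictVars K F f = 0 := mem_nonfaceIdeal_iff.1 f.2 F hF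
    have hf' : restrictVars K (F ∩ Aᶜ) f = 0 := by
      rw [Set.inter_comm, ← restrictVars_restrictVars, hf, map_zero]
    simp only [Submodule.coe_smul, smul_eq_mul, Derivation.leibniz, map_add, map_mul, map_sub,
      restrictVars_restrictVars, hf', RingHom.id_apply, zero_mul, add_zero, ← sub_mul]
    -- What is left is the difference between s and its restriction to Aᶜ, times the restricted ∂f.
    -- On F ⊆ A the latter is the coefficient of x_v in f, zero because v is a vertex; on F ⊆ Aᶜ the
    -- difference vanishes.
    rcases h𝓕 F hF with h | h
    · have h0 : F ∩ Aᶜ = ∅ := Set.disjoint_iff_inter_eq_empty.1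
        (Set.disjoint_compl_right_iff_subset.2 h)
      obtain ⟨G, hG, hvG⟩ := hv
      have hc : coeff (Finsupp.single v 1) (f : MvPolynomial W K) = 0 := by
        by_contra hc
        refine mem_nonfaceIdeal_iff_support.1 f.2 _ (mem_support_iff.2 hc) G hG fun i hi => ?_
        obtain rfl : i = v := by simpa using Finsupp.support_single_subset hi
        exact hvG
      rw [h0, restrictVars_empty (pderiv v _), constantCoeff_pderiv, hc]
      simp
    · rw [Set.inter_eq_left.2 h, sub_self, zero_mul]

theorem pderivRestrictHom_apply (h𝓕 : ∀ F ∈ 𝓕, F ⊆ A ∨ F ⊆ Aᶜ) {v : W}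
    (hv : ∃ F ∈ 𝓕, v ∈ F) (f : nonfaceIdeal K 𝓕) :
    pderivRestrictHom h𝓕 hv f = Ideal.Quotient.mk _ (restrictVars K Aᶜ (pderiv v f)) :=
  rfl

theorem pderivRestrictHom_mem_homDegree [DecidableEq W] (h𝓕 : ∀ F ∈ 𝓕, F ⊆ A ∨ F ⊆ Aᶜ) {v : W}
    (hv : ∃ F ∈ 𝓕, v ∈ F) :
    pderivRestrictHom (K := K) h𝓕 hv ∈ homDegree (nonfaceIdeal K 𝓕) (-Pi.single v 1) := by
  intro f u a hf
  rw [pderivRestrictHom_apply, hf, pderiv_monomial]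
  by_cases hu : u v = 0
  · simp [hu]
  by_cases h : ↑(u - Finsupp.single v 1).support ⊆ Aᶜ
  · rw [restrictVars_monomial_of_subset _ h]
    refine mk_monomial_mem_quotientDegree (fun i => ?_) _
    rw [Finsupp.tsub_apply, Finsupp.single_apply, Pi.neg_apply, Pi.single_apply]
    grind
  · rw [restrictVars_monomial_of_not_subset _ h, map_zero]
    exact Submodule.zero_mem _

theorem pderivRestrictHom_notMem_range (h𝓕 : ∀ F ∈ 𝓕, F ⊆ A ∨ F ⊆ Aᶜ)
    (hcov : ∀ i, ∃ F ∈ 𝓕, i ∈ F) {N : Finset W} (hNA : ↑N ⊆ A) (hN : ∀ F ∈ 𝓕, ¬ ↑N ⊆ F)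
    {v : W} (hv : v ∈ N) (hmin : ∃ F ∈ 𝓕, (N : Set W) \ {v} ⊆ F) {w : W} (hw : w ∉ A) :
    pderivRestrictHom (K := K) h𝓕 (hcov v) ∉
      LinearMap.range (derivationToHom K (nonfaceIdeal K 𝓕)) := by
  classical
  rintro ⟨D, hD⟩
  have hD : ∀ f ∈ nonfaceIdeal K 𝓕, ∀ F ∈ 𝓕,
      restrictVars K F (D f) = restrictVars K F (restrictVars K Aᶜ (pderiv v f)) := by
    intro f hf F hF
    have h := Ideal.Quotient.eq.1 (LinearMap.congr_fun hD ⟨f, hf⟩)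
    have := mem_nonfaceIdeal_iff.1 h F hF
    rwa [map_sub, sub_eq_zero] at this
  have hvw : v ≠ w := fun h => hw (h ▸ hNA hv)
  have hvA : v ∉ Aᶜ := fun h => h (hNA hv)
  -- Evaluate at x_v x_w on a face through w, where x_v vanishes: x_w · D x_v = x_w.
  have h1 : constantCoeff (D (X v)) = 1 := by
    obtain ⟨F, hF, hwF⟩ := hcov w
    have hFA : F ⊆ Aᶜ := (h𝓕 F hF).resolve_left fun h => hw (h hwF)
    have := hD _ (X_mul_X_mem_nonfaceIdeal h𝓕 (hNA hv) hw) F hF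
    simp only [Derivation.leibniz, smul_eq_mul, map_add, map_mul, pderiv_X_self,
      pderiv_X_of_ne hvw.symm, restrictVars_X_of_mem hwF,
      restrictVars_X_of_notMem fun h => hvA (hFA h), restrictVars_X_of_mem (hFA hwF), zero_mul,
      mul_zero, zero_add, map_one] at this
    have h := congrArg constantCoeff (mul_left_cancel₀ (X_ne_zero w) this)
    rwa [constantCoeff_restrictVars, map_one] at h
  -- Evaluate at x_N on a face containing N \ {v} but not v: the product over N \ {v}, times D x_v,
  -- is 0. The right side vanishes because N \ {v} is a nonempty subset of A.
  have h0 : constantCoeff (D (X v)) = 0 := by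
    obtain ⟨F, hF, hNF⟩ := hmin
    have hvF : v ∉ F := fun h => hN F hF fun i hi => by
      by_cases hiv : i = v
      · exact hiv ▸ h
      · exact hNF ⟨hi, hiv⟩
    obtain ⟨j, hj⟩ : (N.erase v).Nonempty := by
      rw [Finset.nonempty_iff_ne_empty]
      intro h
      obtain ⟨G, hG, hvG⟩ := hcov v
      refine hN G hG fun i hi => ?_
      by_cases hiv : i = v
      · exact hiv ▸ hvG
      · have : i ∈ N.erase v := Finset.mem_erase.2 ⟨hiv, hi⟩
        simp [h] at this
    have hP : restrictVars K Aᶜ (∏ i ∈ N.erase v, X i) = 0 := by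
      rw [map_prod]
      exact Finset.prod_eq_zero hj
        (restrictVars_X_of_notMem fun h => h (hNA (Finset.mem_of_mem_erase hj)))
    have hP' : restrictVars K F (∏ i ∈ N.erase v, X i) = ∏ i ∈ N.erase v, X i := by
      rw [map_prod]
      refine Finset.prod_congr rfl fun i hi => restrictVars_X_of_mem (hNF ?_)
      exact ⟨Finset.mem_of_mem_erase hi, Finset.ne_of_mem_erase hi⟩
    have hmem : (X v * ∏ i ∈ N.erase v, X i : MvPolynomial W K) ∈ nonfaceIdeal K 𝓕 := by
      rw [Finset.mul_prod_erase N _ hv]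
      exact prod_X_mem_nonfaceIdeal hN
    have := hD _ hmem F hF
    simp only [Derivation.leibniz, smul_eq_mul, map_add, map_mul, pderiv_X_self, hP, hP',
      restrictVars_X_of_notMem hvF, restrictVars_X_of_notMem hvA, map_zero, zero_mul,
      zero_add] at this
    have hne : (∏ i ∈ N.erase v, X i : MvPolynomial W K) ≠ 0 :=
      Finset.prod_ne_zero_iff.2 fun i _ => X_ne_zero i
    rw [← constantCoeff_restrictVars F, (mul_eq_zero.1 this).resolve_left hne, map_zero]
  exact one_ne_zero (h1.symm.trans h0)

end Nonface

/-! ### The principal case: two points -/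

section Principal

/-- The homomorphism on the ideal generated by `x^e` that maps `x^e` to `1`. -/
noncomputable def divMonomialHom (e : W →₀ ℕ) :
    (Ideal.span {monomial e (1 : K)} : Ideal (MvPolynomial W K)) →ₗ[MvPolynomial W K]
      MvPolynomial W K ⧸ Ideal.span {monomial e (1 : K)} where
  toFun f := Ideal.Quotient.mk _ (divMonomial (f : MvPolynomial W K) e)
  map_add' f g := by
    rw [Submodule.coe_add, add_divMonomial, map_add]
  map_smul' s f := by
    obtain ⟨g, hg⟩ := Ideal.mem_span_singleton.1 f.2
    rw [Submodule.coe_smul, hg, smul_eq_mul, mul_left_comm, divMonomial_monomial_mul,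
      divMonomial_monomial_mul]
    rfl

theorem divMonomialHom_apply (e : W →₀ ℕ)
    (f : (Ideal.span {monomial e (1 : K)} : Ideal (MvPolynomial W K))) :
    divMonomialHom e f = Ideal.Quotient.mk _ (divMonomial (f : MvPolynomial W K) e) :=
  rfl

theorem divMonomialHom_mem_homDegree (e : W →₀ ℕ) :
    divMonomialHom (K := K) e ∈ homDegree _ (-fun v => (e v : ℤ)) := by
  intro f u a hf
  rw [divMonomialHom_apply, hf]
  by_cases ha : a = 0
  · rw [ha, monomial_zero, zero_divMonomial, map_zero]
    exact Submodule.zero_mem _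
  have hle : e ≤ u := by
    have h := Ideal.mem_span_singleton.1 f.2
    rw [hf, monomial_dvd_monomial] at h
    exact h.1.resolve_left ha
  have hu : monomial u a = monomial e 1 * monomial (u - e) a := by
    rw [monomial_mul, one_mul, add_tsub_cancel_of_le hle]
  rw [hu, divMonomial_monomial_mul]
  refine mk_monomial_mem_quotientDegree (fun i => ?_) _
  rw [Finsupp.tsub_apply, Nat.cast_sub (hle i), Pi.neg_apply, sub_eq_add_neg]

/-- By the Leibniz rule every derivation maps x_a x_b into the ideal (x_a, x_b), so its value has no
constant term and cannot be 1 modulo (x_a x_b). -/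
theorem divMonomialHom_notMem_range (a b : W) :
    divMonomialHom (K := K) (Finsupp.single a 1 + Finsupp.single b 1) ∉
      LinearMap.range (derivationToHom K _) := by
  rintro ⟨D, hD⟩
  have hX : monomial (Finsupp.single a 1 + Finsupp.single b 1) (1 : K) = X a * X b := by
    simp [X, monomial_mul]
  have h := LinearMap.congr_fun hD
    ⟨monomial (Finsupp.single a 1 + Finsupp.single b 1) 1, Ideal.mem_span_singleton_self _⟩
  rw [divMonomialHom_apply, divMonomial_monomial] at h
  replace h := Ideal.Quotient.eq.1 h
  rw [hX] at h
  obtain ⟨g, hg⟩ := Ideal.mem_span_singleton.1 h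
  have := congrArg constantCoeff hg
  simp at this

end Principal

end MvPolynomial

/-! ### Separation of a complex whose faces lie in a set or in its complement -/

namespace MvPolynomial

variable {K : Type*} [Field K] {W : Type*}

theorem restrictVars_X_sub_X_ne_zero {F : Set W} {i j : W} (hij : i ≠ j) (h : i ∈ F ∨ j ∈ F) :
    restrictVars K F (X i - X j) ≠ 0 := by
  intro h0
  rw [map_sub, sub_eq_zero] at h0
  by_cases hi : i ∈ F <;> by_cases hj : j ∈ F
  · rw [restrictVars_X_of_mem hi, restrictVars_X_of_mem hj] at h0
    exact hij (X_injective h0)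
  · rw [restrictVars_X_of_mem hi, restrictVars_X_of_notMem hj] at h0
    exact X_ne_zero i h0
  · rw [restrictVars_X_of_notMem hi, restrictVars_X_of_mem hj] at h0
    exact X_ne_zero j h0.symm
  · exact h.elim hi hj

/-- The facets of the complex obtained from a complex with faces in `A` or in `Aᶜ` by splitting
the vertex `v` into `v` and a new vertex `none`: the cone with apex `none` over the faces in `A`
and the cone with apex `v` over the faces in `Aᶜ`. -/
def splitFaces (𝓕 : Set (Set W)) (A : Set W) (v : W) : Set (Set (Option W)) :=
  {G | ∃ F ∈ 𝓕, F ⊆ A ∧ G = insert none (some '' F)} ∪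
    {G | ∃ F ∈ 𝓕, F ⊆ Aᶜ ∧ G = insert (some v) (some '' F)}

theorem isSeparation_nonfaceIdeal_splitFaces {𝓕 : Set (Set W)} {A : Set W}
    (h𝓕 : ∀ F ∈ 𝓕, F ⊆ A ∨ F ⊆ Aᶜ) (hcov : ∀ i, ∃ F ∈ 𝓕, i ∈ F) {N : Finset W} (hNA : ↑N ⊆ A)
    (hN : ∀ F ∈ 𝓕, ¬ ↑N ⊆ F) (hmin : ∀ i ∈ N, ∃ F ∈ 𝓕, (N : Set W) \ {i} ⊆ F) {v : W}
    (hv : v ∈ N) {w : W} (hw : w ∉ A) :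
    IsSeparation (nonfaceIdeal K 𝓕) v (nonfaceIdeal K (splitFaces 𝓕 A v)) := by
  classical
  have hvA : v ∈ A := hNA hv
  have hsplit : ∀ {P : Set (Option W) → Prop}, (∀ F ∈ 𝓕, F ⊆ A → P (insert none (some '' F))) →
      (∀ F ∈ 𝓕, F ⊆ Aᶜ → P (insert (some v) (some '' F))) → ∀ G ∈ splitFaces 𝓕 A v, P G := by
    rintro P h1 h2 G (⟨F, hF, hFA, rfl⟩ | ⟨F, hF, hFA, rfl⟩)
    exacts [h1 F hF hFA, h2 F hF hFA]
  -- Every single vertex lies in a face, so a non-face has at least two elements.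
  have hNi : ∀ i, ∃ j ∈ N, j ≠ i := by
    intro i
    by_contra! h
    obtain ⟨F, hF, hiF⟩ := hcov i
    exact hN F hF fun j hj => h j hj ▸ hiF
  have hmin' : ∀ i ∈ N, ∃ F ∈ 𝓕, F ⊆ A ∧ (N : Set W) \ {i} ⊆ F := by
    intro i hi
    obtain ⟨F, hF, hNF⟩ := hmin i hi
    obtain ⟨j, hj, hji⟩ := hNi i
    exact ⟨F, hF, (h𝓕 F hF).resolve_right fun h => h (hNF ⟨hj, hji⟩) (hNA hj), hNF⟩
  constructor
  · exact isMonomialIdeal_nonfaceIdeal _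
  · rw [aeval_elim_eq_rename]
    apply le_antisymm
    · rw [Ideal.map_le_iff_le_comap, nonfaceIdeal, Ideal.span_le]
      rintro _ ⟨M, hM, rfl⟩
      rw [SetLike.mem_coe, Ideal.mem_comap, map_prod, mem_nonfaceIdeal_iff]
      intro F hF
      rw [map_prod]
      have hMF : ∃ o ∈ M, o.elim v id ∉ F := by
        by_contra! hMF
        rcases h𝓕 F hF with h | h
        · refine hM _ (Or.inl ⟨F, hF, h, rfl⟩) fun o ho => ?_
          rcases o with _ | c
          · exact Or.inl rfl
          · exact Or.inr ⟨c, hMF _ ho, rfl⟩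
        · refine hM _ (Or.inr ⟨F, hF, h, rfl⟩) fun o ho => ?_
          rcases o with _ | c
          · exact absurd hvA (h (hMF _ ho))
          · exact Or.inr ⟨c, hMF _ ho, rfl⟩
      obtain ⟨o, ho, hoF⟩ := hMF
      refine Finset.prod_eq_zero ho ?_
      rw [rename_X, restrictVars_X_of_notMem hoF]
    · rw [nonfaceIdeal, Ideal.span_le]
      rintro _ ⟨M, hM, rfl⟩
      by_cases hM' : ∀ G ∈ splitFaces 𝓕 A v, ¬ ↑(M.map Function.Embedding.some) ⊆ G
      · have := Ideal.mem_map_of_mem (rename (R := K) fun o : Option W => o.elim v id)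
          (prod_X_mem_nonfaceIdeal hM')
        simpa [map_prod] using this
      · push Not at hM'
        obtain ⟨G, ⟨F, hF, hFA, rfl⟩ | ⟨F, hF, hFA, rfl⟩, hMG⟩ := hM'
        · refine absurd (fun i hi => ?_) (hM F hF)
          simpa using @hMG (some i) (by simpa using hi)
        · have hMF : ∀ i ∈ M, i ≠ v → i ∈ F := fun i hi hiv => by
            simpa [hiv] using @hMG (some i) (by simpa using hi)
          have hvM : v ∈ M := by
            by_contra hvM
            exact hM F hF fun i hi => hMF i hi fun h => hvM (h ▸ hi)
          have hMv : ∃ j ∈ M, j ≠ v := by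
            by_contra! h
            obtain ⟨E, hE, hvE⟩ := hcov v
            exact hM E hE fun j hj => h j hj ▸ hvE
          -- Here M is v together with part of a face outside A. Replacing v by the new vertex gives
          -- a non-face of the split complex with the same image.
          have hM'' : ∀ G ∈ splitFaces 𝓕 A v,
              ¬ ↑(insert none ((M.erase v).map Function.Embedding.some)) ⊆ G := by
            refine hsplit (fun E hE hEA h => ?_) fun E hE hEA h => ?_
            · obtain ⟨j, hj, hjv⟩ := hMv
              have hjE : j ∈ E := by simpa using @h (some j) (by simp [hj, hjv])
              exact hFA (hMF j hj hjv) (hEA hjE)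
            · simpa using @h none (by simp)
          have := Ideal.mem_map_of_mem (rename (R := K) fun o : Option W => o.elim v id)
            (prod_X_mem_nonfaceIdeal hM'')
          rw [Finset.prod_insert (by simp), Finset.prod_map, map_mul, map_prod] at this
          simp only [rename_X, Function.Embedding.some_apply, Option.elim_some, Option.elim_none,
            id, Finset.mul_prod_erase M X hvM] at this
          exact this
  · refine ⟨squarefreeExponent (N.map Function.Embedding.some),
      isMinimalGenerator_squarefreeExponent
        (hsplit (fun F hF hFA h => hN F hF fun i hi => ?_) fun F hF hFA h => ?_) ?_, ?_⟩
    · simpa using @h (some i) (by simpa using hi)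
    · obtain ⟨j, hj, hjv⟩ := hNi v
      have hjF : j ∈ F := by simpa [hjv] using @h (some j) (by simpa using hj)
      exact hFA hjF (hNA hj)
    · intro o ho
      obtain ⟨i, hi, rfl⟩ := Finset.mem_map.1 ho
      obtain ⟨F, hF, hFA, hNF⟩ := hmin' i hi
      refine ⟨_, Or.inl ⟨F, hF, hFA, rfl⟩, ?_⟩
      rintro _ ⟨hj, hji⟩
      obtain ⟨j, hj', rfl⟩ := Finset.mem_map.1 hj
      exact Or.inr ⟨j, hNF ⟨hj', fun h => hji (congrArg some h)⟩, rfl⟩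
    · rw [squarefreeExponent_apply, if_pos (by simpa using hv)]
      exact one_ne_zero
  · obtain ⟨E, hE, hwE⟩ := hcov w
    have hEA : E ⊆ Aᶜ := (h𝓕 E hE).resolve_left fun h => hw (h hwE)
    obtain ⟨G, hG, hvG⟩ := hcov v
    have hGA : G ⊆ A := (h𝓕 G hG).resolve_right fun h => h hvG hvA
    -- The new vertex is joined only to the A side, so it and w span no face, while each of them
    -- alone is a vertex.
    refine ⟨squarefreeExponent {none, some w}, isMinimalGenerator_squarefreeExponent
      (hsplit (fun F hF hFA h => ?_) fun F hF hFA h => ?_) ?_, ?_⟩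
    · exact hw (hFA (by simpa using @h (some w) (by simp)))
    · simpa using @h none (by simp)
    · intro o ho
      rcases Finset.mem_insert.1 ho with rfl | ho
      · exact ⟨_, Or.inr ⟨E, hE, hEA, rfl⟩, by rintro o ⟨ho, ho'⟩; grind⟩
      · exact ⟨_, Or.inl ⟨G, hG, hGA, rfl⟩, by rintro o ⟨ho, ho'⟩; grind⟩
    · rw [squarefreeExponent_apply, if_pos (by simp)]
      exact one_ne_zero
  · rw [mem_nonZeroDivisors_iff_right]
    refine Ideal.Quotient.mk_surjective.forall.2 fun f hf => ?_
    rw [← map_mul, Ideal.Quotient.eq_zero_iff_mem, mem_nonfaceIdeal_iff] at hf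
    rw [Ideal.Quotient.eq_zero_iff_mem, mem_nonfaceIdeal_iff]
    intro G hG
    have h := hf G hG
    rw [map_mul] at h
    -- Every set of `splitFaces` is a cone with apex y or x_v, so y - x_v is nonzero on it and
    -- cancels in a domain.
    refine (mul_eq_zero.1 h).resolve_right (restrictVars_X_sub_X_ne_zero (by simp) ?_)
    exact hsplit (P := fun G => none ∈ G ∨ some v ∈ G) (fun _ _ _ => by simp)
      (fun _ _ _ => by simp) G hG

end MvPolynomial

/-! ### Disjoint unions -/

theorem mem_range_derivationToHom_of_cotangentT1Degree_eq_bot {K V : Type*} [Field K]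
    {I : Ideal (MvPolynomial V K)} {c : V → ℤ} (h : cotangentT1Degree I c = ⊥)
    {φ : I →ₗ[MvPolynomial V K] MvPolynomial V K ⧸ I} (hφ : φ ∈ homDegree I c) :
    φ ∈ LinearMap.range (derivationToHom K I) := by
  have h0 : (LinearMap.range (derivationToHom K I)).mkQ φ ∈ cotangentT1Degree I c :=
    Submodule.mem_map_of_mem (f := (LinearMap.range (derivationToHom K I)).mkQ.restrictScalars K) hφ
  rw [h, Submodule.mem_bot] at h0
  exact (Submodule.Quotient.mk_eq_zero _).1 h0

theorem cotangentT1Degree_eq_bot_of_surjective {K V : Type*} [Field K]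
    {I : Ideal (MvPolynomial V K)} (h : Function.Surjective (derivationToHom K I)) (c : V → ℤ) :
    cotangentT1Degree I c = ⊥ := by
  rw [eq_bot_iff]
  rintro _ ⟨φ, -, rfl⟩
  exact (Submodule.Quotient.mk_eq_zero _).2 (h φ)

namespace PreAbstractSimplicialComplex

open MvPolynomial

section

variable {V : Type*} {Δ : PreAbstractSimplicialComplex V}

theorem nonempty_of_ne_bot (h : Δ ≠ ⊥) : Nonempty V := by
  by_contra hV
  rw [not_nonempty_iff] at hV
  refine h (PreAbstractSimplicialComplex.ext (Set.eq_empty_of_forall_notMem fun F hF => ?_))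
  exact hV.elim (Δ.isRelLowerSet_faces hF).1.choose

theorem isSimplex_iff [Finite V] (hvert : ∀ v, {v} ∈ Δ.faces) :
    Δ.IsSimplex ↔ ∀ G : Finset V, G.Nonempty → G ∈ Δ.faces := by
  constructor
  · rintro ⟨F, hF⟩ G hG
    exact (hF G).2 ⟨hG, fun v _ => Finset.singleton_subset_iff.1 ((hF {v}).1 (hvert v)).2⟩
  · intro h
    have := Fintype.ofFinite V
    exact ⟨Finset.univ, fun G => ⟨fun hG => ⟨(Δ.isRelLowerSet_faces hG).1, Finset.subset_univ G⟩,
      fun hG => h G hG.1⟩⟩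

theorem exists_minimal_nonface [Finite V] [DecidableEq V] (hvert : ∀ v, {v} ∈ Δ.faces)
    (hΔ : ¬ Δ.IsSimplex) : ∃ N : Finset V, N.Nonempty ∧ N ∉ Δ.faces ∧
      ∀ i ∈ N, N.erase i = ∅ ∨ N.erase i ∈ Δ.faces := by
  rw [isSimplex_iff hvert] at hΔ
  push Not at hΔ
  obtain ⟨N, ⟨hN, hN'⟩, hmin⟩ :=
    WellFounded.has_min (wellFounded_lt (α := Finset V)) {G | G.Nonempty ∧ G ∉ Δ.faces} hΔ
  refine ⟨N, hN, hN', fun i hi => ?_⟩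
  by_contra! h
  exact hmin _ h (Finset.erase_ssubset hi)

theorem IsSimplex.dim_eq [Finite V] [Nonempty V] (hvert : ∀ v, {v} ∈ Δ.faces)
    (hΔ : Δ.IsSimplex) : Δ.dim = (Nat.card V : ℤ) - 1 := by
  have := Fintype.ofFinite V
  have hmax : IsGreatest (Finset.card '' Δ.faces) (Nat.card V) := by
    rw [Nat.card_eq_fintype_card]
    refine ⟨⟨Finset.univ, (isSimplex_iff hvert).1 hΔ _ Finset.univ_nonempty, Finset.card_univ⟩, ?_⟩
    rintro _ ⟨F, -, rfl⟩
    exact Finset.card_le_univ F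
  rw [dim, hmax.csSup_eq]

variable (K : Type*) [Field K] {A : Set V} {N : Finset V} {w : V}

variable {K} in
theorem IsEmptyRigid.cotangentT1Degree_eq_bot (h : Δ.IsEmptyRigid K)
    {I : Ideal (MvPolynomial V K)} (hI : Δ.stanleyReisnerIdeal K = I) {b : V → ℤ}
    (hb : ∀ v, b v = 0 ∨ b v = 1) : cotangentT1Degree I (-b) = ⊥ := by
  subst hI
  exact h b hb

theorem not_isInseparable_of_minimal_nonface
    (h𝓕 : ∀ F ∈ Δ.faceSets, F ⊆ A ∨ F ⊆ Aᶜ) (hcov : ∀ i, ∃ F ∈ Δ.faceSets, i ∈ F)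
    (hNA : ↑N ⊆ A) (hN : ∀ F ∈ Δ.faceSets, ¬ ↑N ⊆ F)
    (hmin : ∀ i ∈ N, ∃ F ∈ Δ.faceSets, (N : Set V) \ {i} ⊆ F) (hw : w ∉ A) :
    ¬ Δ.IsInseparable K := by
  -- The empty face witnesses that N is nonempty.
  obtain ⟨v, hv, -⟩ := Set.not_subset.1 (hN ∅ (Or.inl rfl))
  rw [IsInseparable, not_not, stanleyReisnerIdeal_eq_nonfaceIdeal]
  exact ⟨v, _, isSeparation_nonfaceIdeal_splitFaces h𝓕 hcov hNA hN hmin hv hw⟩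

theorem not_isEmptyRigid_of_minimal_nonface
    (h𝓕 : ∀ F ∈ Δ.faceSets, F ⊆ A ∨ F ⊆ Aᶜ) (hcov : ∀ i, ∃ F ∈ Δ.faceSets, i ∈ F)
    (hNA : ↑N ⊆ A) (hN : ∀ F ∈ Δ.faceSets, ¬ ↑N ⊆ F)
    (hmin : ∀ i ∈ N, ∃ F ∈ Δ.faceSets, (N : Set V) \ {i} ⊆ F) (hw : w ∉ A) :
    ¬ Δ.IsEmptyRigid K := by
  classical
  obtain ⟨v, hv, -⟩ := Set.not_subset.1 (hN ∅ (Or.inl rfl))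
  intro h
  refine pderivRestrictHom_notMem_range (K := K) h𝓕 hcov hNA hN hv (hmin v hv) hw
    (mem_range_derivationToHom_of_cotangentT1Degree_eq_bot (h.cotangentT1Degree_eq_bot
      (Δ.stanleyReisnerIdeal_eq_nonfaceIdeal K) (b := Pi.single v 1) fun i => ?_)
      (pderivRestrictHom_mem_homDegree h𝓕 (hcov v)))
  rw [Pi.single_apply]
  split_ifs <;> simp

end

section DisjointUnion

variable {V₁ V₂ : Type*} {Δ₁ : PreAbstractSimplicialComplex V₁}
  {Δ₂ : PreAbstractSimplicialComplex V₂}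

theorem mem_faces_disjointUnion {G : Finset (V₁ ⊕ V₂)} :
    G ∈ (Δ₁.disjointUnion Δ₂).faces ↔ (∃ F ∈ Δ₁.faces, F.map .inl = G) ∨
      ∃ F ∈ Δ₂.faces, F.map .inr = G := by
  classical
  simp only [Finset.map_eq_image]
  exact Iff.rfl

theorem map_inl_mem_faces_disjointUnion {F : Finset V₁} (hF : F.Nonempty) :
    F.map .inl ∈ (Δ₁.disjointUnion Δ₂).faces ↔ F ∈ Δ₁.faces := by
  rw [mem_faces_disjointUnion]
  constructor
  · rintro (⟨G, hG, h⟩ | ⟨G, hG, h⟩)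
    · rwa [← Finset.map_injective _ h]
    · obtain ⟨i, hi⟩ := hF
      have : Sum.inl i ∈ G.map (.inr : V₂ ↪ V₁ ⊕ V₂) := h ▸ Finset.mem_map_of_mem .inl hi
      simp at this
  · exact fun h => Or.inl ⟨F, h, rfl⟩

theorem map_inr_mem_faces_disjointUnion {F : Finset V₂} (hF : F.Nonempty) :
    F.map .inr ∈ (Δ₁.disjointUnion Δ₂).faces ↔ F ∈ Δ₂.faces := by
  rw [mem_faces_disjointUnion]
  constructor
  · rintro (⟨G, hG, h⟩ | ⟨G, hG, h⟩)
    · obtain ⟨i, hi⟩ := hF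
      have : Sum.inr i ∈ G.map (.inl : V₁ ↪ V₁ ⊕ V₂) := h ▸ Finset.mem_map_of_mem .inr hi
      simp at this
    · rwa [← Finset.map_injective _ h]
  · exact fun h => Or.inr ⟨F, h, rfl⟩

theorem faceSets_disjointUnion_subset (F : Set (V₁ ⊕ V₂))
    (hF : F ∈ (Δ₁.disjointUnion Δ₂).faceSets) :
    F ⊆ Set.range Sum.inl ∨ F ⊆ (Set.range Sum.inl)ᶜ := by
  rcases hF with rfl | ⟨F, hF, rfl⟩
  · simp
  · rcases mem_faces_disjointUnion.1 hF with ⟨G, -, rfl⟩ | ⟨G, -, rfl⟩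
    · left
      simp
    · right
      simp

theorem exists_mem_faceSets_disjointUnion (hvert₁ : ∀ v, {v} ∈ Δ₁.faces)
    (hvert₂ : ∀ v, {v} ∈ Δ₂.faces) (i : V₁ ⊕ V₂) :
    ∃ F ∈ (Δ₁.disjointUnion Δ₂).faceSets, i ∈ F := by
  rcases i with i | i
  · exact ⟨_, Or.inr ⟨_, (map_inl_mem_faces_disjointUnion (Finset.singleton_nonempty i)).2
      (hvert₁ i), rfl⟩, by simp⟩
  · exact ⟨_, Or.inr ⟨_, (map_inr_mem_faces_disjointUnion (Finset.singleton_nonempty i)).2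
      (hvert₂ i), rfl⟩, by simp⟩

/-- A minimal non-face of a complex, embedded into a larger vertex set, is a minimal non-face of
every complex that induces the given one. -/
theorem exists_minimal_nonface_of_embedding {V W : Type*} [Finite V]
    {Δ : PreAbstractSimplicialComplex V} (hvert : ∀ v, {v} ∈ Δ.faces) (hΔ : ¬ Δ.IsSimplex)
    {Γ : PreAbstractSimplicialComplex W} (e : V ↪ W)
    (he : ∀ {F : Finset V}, F.Nonempty → (F.map e ∈ Γ.faces ↔ F ∈ Δ.faces)) :
    ∃ N : Finset W, ↑N ⊆ Set.range e ∧ (∀ F ∈ Γ.faceSets, ¬ ↑N ⊆ F) ∧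
      ∀ i ∈ N, ∃ F ∈ Γ.faceSets, (N : Set W) \ {i} ⊆ F := by
  classical
  obtain ⟨N, hN, hN', hmin⟩ := exists_minimal_nonface hvert hΔ
  refine ⟨N.map e, by simp, fun F hF h => ?_, fun i hi => ?_⟩
  · rcases (Γ.exists_mem_faceSets_iff _).1 ⟨F, hF, h⟩ with h | h
    · exact hN.ne_empty (Finset.map_eq_empty.1 h)
    · exact hN' ((he hN).1 h)
  · obtain ⟨j, hj, rfl⟩ := Finset.mem_map.1 hi
    have hface : (N.map e).erase (e j) = ∅ ∨ (N.map e).erase (e j) ∈ Γ.faces := by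
      rw [← Finset.map_erase]
      rcases hmin j hj with h | h
      · exact Or.inl (Finset.map_eq_empty.2 h)
      · exact Or.inr ((he (Δ.isRelLowerSet_faces h).1).2 h)
    simpa only [Finset.coe_erase] using (Γ.exists_mem_faceSets_iff _).2 hface

variable (K : Type*) [Field K]

theorem not_isInseparable_and_not_isEmptyRigid_disjointUnion [Finite V₁] [Finite V₂] [Nonempty V₁]
    [Nonempty V₂] (hvert₁ : ∀ v, {v} ∈ Δ₁.faces) (hvert₂ : ∀ v, {v} ∈ Δ₂.faces)
    (h : ¬ (Δ₁.IsSimplex ∧ Δ₂.IsSimplex)) :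
    ¬ (Δ₁.disjointUnion Δ₂).IsInseparable K ∧ ¬ (Δ₁.disjointUnion Δ₂).IsEmptyRigid K := by
  have hcov := exists_mem_faceSets_disjointUnion hvert₁ hvert₂
  rcases not_and_or.1 h with h | h
  · obtain ⟨N, hNA, hN, hmin⟩ := exists_minimal_nonface_of_embedding hvert₁ h .inl
      (Γ := Δ₁.disjointUnion Δ₂) map_inl_mem_faces_disjointUnion
    have hw : Sum.inr (Classical.arbitrary V₂) ∉ Set.range (Sum.inl : V₁ → V₁ ⊕ V₂) := by simp
    exact ⟨not_isInseparable_of_minimal_nonface K faceSets_disjointUnion_subset hcov hNA hN hmin hw,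
      not_isEmptyRigid_of_minimal_nonface K faceSets_disjointUnion_subset hcov hNA hN hmin hw⟩
  · obtain ⟨N, hNA, hN, hmin⟩ := exists_minimal_nonface_of_embedding hvert₂ h .inr
      (Γ := Δ₁.disjointUnion Δ₂) map_inr_mem_faces_disjointUnion
    have hw : Sum.inl (Classical.arbitrary V₁) ∉ Set.range (Sum.inr : V₂ → V₁ ⊕ V₂) := by simp
    have h𝓕 : ∀ F ∈ (Δ₁.disjointUnion Δ₂).faceSets,
        F ⊆ Set.range Sum.inr ∨ F ⊆ (Set.range Sum.inr)ᶜ := fun F hF => by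
      rw [Set.compl_range_inr, ← Set.compl_range_inl]
      exact (faceSets_disjointUnion_subset F hF).symm
    exact ⟨not_isInseparable_of_minimal_nonface K h𝓕 hcov hNA hN hmin hw,
      not_isEmptyRigid_of_minimal_nonface K h𝓕 hcov hNA hN hmin hw⟩

theorem stanleyReisnerIdeal_disjointUnion_of_isSimplex [Finite V₁] [Finite V₂]
    (hvert₁ : ∀ v, {v} ∈ Δ₁.faces) (hvert₂ : ∀ v, {v} ∈ Δ₂.faces) (h₁ : Δ₁.IsSimplex)
    (h₂ : Δ₂.IsSimplex) : (Δ₁.disjointUnion Δ₂).stanleyReisnerIdeal K =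
      nonfaceIdeal K {Set.range Sum.inl, (Set.range Sum.inl)ᶜ} := by
  classical
  rw [isSimplex_iff hvert₁] at h₁
  rw [isSimplex_iff hvert₂] at h₂
  rw [stanleyReisnerIdeal_eq_nonfaceIdeal]
  refine nonfaceIdeal_congr fun N => ⟨?_, ?_⟩
  · rintro ⟨F, hF, hN⟩
    rcases faceSets_disjointUnion_subset F hF with h | h
    · exact ⟨_, Or.inl rfl, hN.trans h⟩
    · exact ⟨_, Or.inr rfl, hN.trans h⟩
  · rintro ⟨F, hF, hN⟩
    rw [exists_mem_faceSets_iff]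
    rcases N.eq_empty_or_nonempty with h0 | h0
    · exact Or.inl h0
    right
    rw [mem_faces_disjointUnion]
    rcases hF with rfl | rfl
    · left
      obtain ⟨M, rfl⟩ : ∃ M : Finset V₁, M.map .inl = N := by
        refine ⟨N.toLeft, ?_⟩
        ext i
        rcases i with i | i
        · simp
        · have : Sum.inr i ∉ N := fun hi => by simpa using hN hi
          simpa using this
      exact ⟨M, h₁ M (Finset.map_nonempty.1 h0), rfl⟩
    · right
      obtain ⟨M, rfl⟩ : ∃ M : Finset V₂, M.map .inr = N := by
        refine ⟨N.toRight, ?_⟩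
        ext i
        rcases i with i | i
        · have : Sum.inl i ∉ N := fun hi => by simpa using hN hi
          simpa using this
        · simp
      exact ⟨M, h₂ M (Finset.map_nonempty.1 h0), rfl⟩

theorem isInseparable_disjointUnion_of_isSimplex [Finite V₁] [Finite V₂]
    (hvert₁ : ∀ v, {v} ∈ Δ₁.faces) (hvert₂ : ∀ v, {v} ∈ Δ₂.faces) (h₁ : Δ₁.IsSimplex)
    (h₂ : Δ₂.IsSimplex) : (Δ₁.disjointUnion Δ₂).IsInseparable K := by
  rintro ⟨v, J, hJ⟩
  rw [stanleyReisnerIdeal_disjointUnion_of_isSimplex K hvert₁ hvert₂ h₁ h₂] at hJ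
  by_cases hv : v ∈ Set.range (Sum.inl : V₁ → V₁ ⊕ V₂)
  · exact not_isSeparation_nonfaceIdeal_compl hv J hJ
  -- The ideal is symmetric in A and Aᶜ, so the side containing v may be taken as A.
  · refine not_isSeparation_nonfaceIdeal_compl (A := (Set.range Sum.inl)ᶜ) hv J ?_
    rwa [compl_compl, Set.pair_comm]

theorem surjective_derivationToHom_disjointUnion_of_isSimplex [Finite V₁] [Finite V₂]
    (hvert₁ : ∀ v, {v} ∈ Δ₁.faces) (hvert₂ : ∀ v, {v} ∈ Δ₂.faces) (h₁ : Δ₁.IsSimplex)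
    (h₂ : Δ₂.IsSimplex) (h : Nontrivial V₁ ∨ Nontrivial V₂) :
    Function.Surjective (derivationToHom K ((Δ₁.disjointUnion Δ₂).stanleyReisnerIdeal K)) := by
  rw [stanleyReisnerIdeal_disjointUnion_of_isSimplex K hvert₁ hvert₂ h₁ h₂]
  rcases h with h | h
  · refine surjective_derivationToHom_nonfaceIdeal_compl ?_
    rw [← Set.image_univ]
    exact Set.nontrivial_univ.image Sum.inl_injective
  · have : (Set.range (Sum.inl : V₁ → V₁ ⊕ V₂))ᶜ.Nontrivial := by
      rw [Set.compl_range_inl, ← Set.image_univ]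
      exact Set.nontrivial_univ.image Sum.inr_injective
    have h := surjective_derivationToHom_nonfaceIdeal_compl (K := K) this
    rwa [compl_compl, Set.pair_comm] at h

theorem not_isEmptyRigid_disjointUnion_of_subsingleton [Nonempty V₁] [Nonempty V₂] [Subsingleton V₁]
    [Subsingleton V₂] (hvert₁ : ∀ v, {v} ∈ Δ₁.faces) (hvert₂ : ∀ v, {v} ∈ Δ₂.faces)
    (h₁ : Δ₁.IsSimplex) (h₂ : Δ₂.IsSimplex) : ¬ (Δ₁.disjointUnion Δ₂).IsEmptyRigid K := by
  classical
  obtain ⟨a⟩ := ‹Nonempty V₁›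
  obtain ⟨b⟩ := ‹Nonempty V₂›
  have hI : (Δ₁.disjointUnion Δ₂).stanleyReisnerIdeal K =
      Ideal.span {monomial (Finsupp.single (Sum.inl a) 1 + Finsupp.single (Sum.inr b) 1) 1} := by
    rw [stanleyReisnerIdeal_disjointUnion_of_isSimplex K hvert₁ hvert₂ h₁ h₂,
      nonfaceIdeal_compl_eq_span]
    congr 1
    have hX : monomial (Finsupp.single (Sum.inl a) 1 + Finsupp.single (Sum.inr b) 1) (1 : K) =
        X (Sum.inl a) * X (Sum.inr b) := by simp [X, monomial_mul]
    rw [hX]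
    ext f
    constructor
    · rintro ⟨_, ⟨i, rfl⟩, j | j, hj, rfl⟩
      · simp at hj
      · rw [Subsingleton.elim i a, Subsingleton.elim j b]
        rfl
    · rintro rfl
      exact ⟨_, ⟨a, rfl⟩, _, by simp, rfl⟩
  intro h
  refine divMonomialHom_notMem_range (K := K) (Sum.inl a) (Sum.inr b)
    (mem_range_derivationToHom_of_cotangentT1Degree_eq_bot (h.cotangentT1Degree_eq_bot hI fun i => ?_)
      (divMonomialHom_mem_homDegree _))
  rcases i with i | i
  · simp [Subsingleton.elim a i]
  · simp [Subsingleton.elim b i]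

end DisjointUnion

end PreAbstractSimplicialComplex

open PreAbstractSimplicialComplex in
theorem mainTheorem3 (K : Type*) [Field K] {V₁ V₂ : Type*} [Finite V₁] [Finite V₂]
    (Δ₁ : PreAbstractSimplicialComplex V₁) (Δ₂ : PreAbstractSimplicialComplex V₂)
    (hne₁ : Δ₁ ≠ ⊥) (hne₂ : Δ₂ ≠ ⊥)
    (hvert₁ : ∀ v, {v} ∈ Δ₁.faces) (hvert₂ : ∀ v, {v} ∈ Δ₂.faces) :
    ((Δ₁.disjointUnion Δ₂).IsInseparable K ↔ Δ₁.IsSimplex ∧ Δ₂.IsSimplex) ∧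
    List.TFAE [
      (Δ₁.disjointUnion Δ₂).IsRigid K,
      (Δ₁.disjointUnion Δ₂).IsEmptyRigid K,
      Δ₁.IsSimplex ∧ Δ₂.IsSimplex ∧ 0 < Δ₁.dim + Δ₂.dim] := by
  have := nonempty_of_ne_bot hne₁
  have := nonempty_of_ne_bot hne₂
  -- Each dimension is the number of vertices minus one, hence nonnegative; the sum vanishes only
  -- for two points.
  have hdim : Δ₁.IsSimplex → Δ₂.IsSimplex →
      (0 < Δ₁.dim + Δ₂.dim ↔ Nontrivial V₁ ∨ Nontrivial V₂) := by
    intro h₁ h₂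
    rw [h₁.dim_eq hvert₁, h₂.dim_eq hvert₂, ← Finite.one_lt_card_iff_nontrivial,
      ← Finite.one_lt_card_iff_nontrivial]
    have := Nat.card_pos (α := V₁)
    have := Nat.card_pos (α := V₂)
    omega
  refine ⟨⟨fun h => ?_, fun h =>
    isInseparable_disjointUnion_of_isSimplex K hvert₁ hvert₂ h.1 h.2⟩, ?_⟩
  · by_contra hs
    exact (not_isInseparable_and_not_isEmptyRigid_disjointUnion K hvert₁ hvert₂ hs).1 h
  tfae_have 1 → 2 := fun h b _ =>
    cotangentT1Degree_eq_bot_of_surjective (surjective_of_isRigidQuotient h) _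
  tfae_have 2 → 3 := by
    intro h
    have hs : Δ₁.IsSimplex ∧ Δ₂.IsSimplex := by
      by_contra hs
      exact (not_isInseparable_and_not_isEmptyRigid_disjointUnion K hvert₁ hvert₂ hs).2 h
    refine ⟨hs.1, hs.2, (hdim hs.1 hs.2).2 ?_⟩
    by_contra hn
    simp only [not_or, not_nontrivial_iff_subsingleton] at hn
    obtain ⟨_, _⟩ := hn
    exact not_isEmptyRigid_disjointUnion_of_subsingleton K hvert₁ hvert₂ hs.1 hs.2 h
  tfae_have 3 → 1 := fun ⟨h₁, h₂, h⟩ =>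
    isRigidQuotient_of_surjective (surjective_derivationToHom_disjointUnion_of_isSimplex K hvert₁
      hvert₂ h₁ h₂ ((hdim h₁ h₂).1 h))
  tfae_finish
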